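/- Let $H$ be a complex Hilbert space. **Conventions.** A *unital operator space* is a complex vector space $E$ with norms on all matrix spaces $M_n(E)$, $n\ge 1$, and an element $e\in E$, for which there are a Hilbert space $K$ and a linear map $u\colon E\to B(K)$ with $u(e)=I_K$ such that every amplification $u_n\colon M_n(E)\to M_n(B(K))=B(K^n)$, $[a_{ij}]\mapsto[u(a_{ij})]$, is isometric. A linear subspace of a unital operator space containing its unit is again one, with the inherited matrix norms and unit; subspaces of unital operator spaces are always taken to contain the unit. A linear map $\phi$ between unital operator spaces is *ucc* (resp. *ucis*) if it preserves the unit and every $\phi_n$ is contractive (resp. isometric). A unital operator space $E$ is *injective* if for every unital operator space $Y$ and every subspace $Z\subseteq Y$, each ucc map $Z\to E$ extends to a ucc map $Y\to E$. An *injective envelope* of a unital operator space $X$ is a pair $(E,\iota)$ where $E$ is an injective unital operator space, $\iota\colon X\to E$ is a ucis map, and no proper linear subspace of $E$ containing $\iota(X)$ is injective. Let $X\subseteq B(H)$ be a linear subspace containing $I_H$. * A *boundary subsystem* for $X$ in $B(H)$ is a selfadjoint linear subspace $\mathcal I\subseteq B(H)$ such that for all $n\ge1$ and $[x_{ij}]\in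 M_n(X)$ one has $\inf\{\|[x_{ij}+y_{ij}]\| : y_{ij}\in\mathcal I\}=\|[x_{ij}]\|$ (i.e. the quotient map $B(H)\to B(H)/\mathcal I$ is completely isometric on $X$). It is *maximal* if it is maximal under inclusion among boundary subsystems for $X$ in $B(H)$. * An *$X$-map* is a ucc map $\phi\colon B(H)\to B(H)$ with $\phi(x)=x$ for all $x\in X$; its *$X$-seminorm* is $p_\phi(a)=\|\phi(a)\|$, considered with the matrix seminorms $p_{\phi_n}([a_{ij}])=\|[\phi(a_{ij})]\|$. For $X$-maps $\psi,\phi$ write $p_\psi\le_c p_\phi$ if $\|[\psi(a_{ij})]\|\le\|[\phi(a_{ij})]\|$ for all $n\ge1$ and all $a_{ij}\in B(H)$. The $X$-seminorm $p_\phi$ is *$\le_c$-minimal* if for every $X$-map $\psi$ with $p_\psi\le_c p_\phi$ one has $\|[\psi(a_{ij})]\|=\|[\phi(a_{ij})]\|$ for all $n\ge1$ and all $a_{ij}\in B(H)$. * An *$X$-projection* is an $X$-map $\phi$ with $\phi\circ\phi=\phi$. For $X$-projections write $\psi\prec\phi$ if $\psi\circ\phi=\psi=\phi\circ\psi$; an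 $X$-projection $\phi$ is *$\prec$-minimal* if $\psi\prec\phi$ implies $\psi=\phi$. **Theorem.** Let $X\subseteq B(H)$ be a linear subspace containing $I_H$, and let $\mathcal I$ be a linear subspace of $B(H)$. The following are equivalent: 1. $\mathcal I$ is a maximal boundary subsystem for $X$ in $B(H)$; 2. $\mathcal I=\ker\phi$ for some ucc map $\phi\colon B(H)\to S$, where $(S,\iota)$ is an injective envelope of $X$ and $\phi(x)=\iota(x)$ for all $x\in X$; 3. $\mathcal I=\ker\phi$ for some $X$-map $\phi$ such that $p_\phi$ is a $\le_c$-minimal $X$-seminorm; 4. $\mathcal I=\ker\phi$ for some $\prec$-minimal $X$-projection $\phi$ such that $(\phi(B(H)),\phi|_X)$ is an injective envelope of $X$. -/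

import Mathlib

universe u

noncomputable section

/-- The operator on the Hilbert space `K ⊕ ⋯ ⊕ K` (`n` summands, `ℓ²` norm) given by an `n × n`
matrix of bounded operators on `K`; this is the identification of `M_n(B(K))` with `B(K^n)`. -/
def blockOp {K : Type u} [NormedAddCommGroup K] [InnerProductSpace ℂ K] {n : ℕ}
    (T : Matrix (Fin n) (Fin n) (K →L[ℂ] K)) :
    PiLp 2 (fun _ : Fin n => K) →L[ℂ] PiLp 2 (fun _ : Fin n => K) :=
  ((PiLp.continuousLinearEquiv 2 ℂ (fun _ : Fin n => K)).symm :
      (Fin n → K) →L[ℂ] PiLp 2 (fun _ : Fin n => K)) ∘L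
    (ContinuousLinearMap.pi fun i => ∑ j, T i j ∘L ContinuousLinearMap.proj j) ∘L
    (PiLp.continuousLinearEquiv 2 ℂ (fun _ : Fin n => K) :
      PiLp 2 (fun _ : Fin n => K) →L[ℂ] (Fin n → K))

theorem blockOp_apply {K : Type u} [NormedAddCommGroup K] [InnerProductSpace ℂ K] {n : ℕ}
    (T : Matrix (Fin n) (Fin n) (K →L[ℂ] K)) (v : PiLp 2 (fun _ : Fin n => K)) (i : Fin n) :
    blockOp T v i = ∑ j, T i j (v j) := by
  simp [blockOp]

/-- A unital (abstract) operator space: a complex vector space with a distinguished element and a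
norm on every matrix space over it, for which some injective linear map into a `B(K)` takes the
distinguished element to the identity operator and is isometric on all matrix levels. -/
structure UnitalOperatorSpace : Type (u + 1) where
  carrier : Type u
  [addCommGroup : AddCommGroup carrier]
  [module : Module ℂ carrier]
  one : carrier
  mnorm : (n : ℕ) → Matrix (Fin n) (Fin n) carrier → ℝ
  exists_realization : ∃ (K : Type u) (_ : NormedAddCommGroup K) (_ : InnerProductSpace ℂ K)
    (_ : CompleteSpace K) (r : carrier →ₗ[ℂ] (K →L[ℂ] K)),
      Function.Injective r ∧ r one = 1 ∧
        ∀ (n : ℕ) (A : Matrix (Fin n) (Fin n) carrier), ‖blockOp (A.map r)‖ = mnorm n A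

attribute [instance] UnitalOperatorSpace.addCommGroup UnitalOperatorSpace.module

namespace UnitalOperatorSpace

/-- The unital operator space `B(H)`. -/
abbrev boundedOps (H : Type u) [NormedAddCommGroup H] [InnerProductSpace ℂ H] [CompleteSpace H] :
    UnitalOperatorSpace.{u} where
  carrier := H →L[ℂ] H
  one := 1
  mnorm := fun _ A => ‖blockOp A‖
  exists_realization := ⟨H, inferInstance, inferInstance, inferInstance, LinearMap.id,
    fun _ _ h => h, rfl, fun _ _ => rfl⟩

/-- A linear subspace containing the unit, with the inherited matrix norms. -/
abbrev sub (E : UnitalOperatorSpace.{u}) (F : Submodule ℂ E.carrier) (hF : E.one ∈ F) :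
    UnitalOperatorSpace.{u} where
  carrier := F
  one := ⟨E.one, hF⟩
  mnorm := fun n A => E.mnorm n (A.map fun x => (x : E.carrier))
  exists_realization := by
    obtain ⟨K, i₁, i₂, i₃, r, hr, h1, hn⟩ := E.exists_realization
    exact ⟨K, i₁, i₂, i₃, r ∘ₗ F.subtype, hr.comp Subtype.val_injective, h1,
      fun n A => hn n (A.map fun x => (x : E.carrier))⟩

/-- Unital completely contractive (ucc) maps. -/
structure IsUCC (E F : UnitalOperatorSpace.{u}) (φ : E.carrier →ₗ[ℂ] F.carrier) : Prop where
  map_one : φ E.one = F.one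
  mnorm_le : ∀ (n : ℕ) (A : Matrix (Fin n) (Fin n) E.carrier),
    F.mnorm n (A.map φ) ≤ E.mnorm n A

/-- Unital completely isometric (ucis) maps. -/
structure IsUCIS (E F : UnitalOperatorSpace.{u}) (φ : E.carrier →ₗ[ℂ] F.carrier) : Prop where
  map_one : φ E.one = F.one
  mnorm_eq : ∀ (n : ℕ) (A : Matrix (Fin n) (Fin n) E.carrier),
    F.mnorm n (A.map φ) = E.mnorm n A

/-- Injectivity in the category of unital operator spaces and ucc maps. -/
def IsInjective (E : UnitalOperatorSpace.{u}) : Prop :=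
  ∀ (Y : UnitalOperatorSpace.{u}) (Z : Submodule ℂ Y.carrier) (hZ : Y.one ∈ Z)
    (φ : Z →ₗ[ℂ] E.carrier), IsUCC (Y.sub Z hZ) E φ →
      ∃ ψ : Y.carrier →ₗ[ℂ] E.carrier, IsUCC Y E ψ ∧ ∀ z : Z, ψ z = φ z

/-- `(E, ι)` is an injective envelope of `X`: it is an extension of `X`, `E` is injective, and no
proper linear subspace of `E` that contains `ι(X)` is injective. -/
structure IsInjectiveEnvelope (X E : UnitalOperatorSpace.{u})
    (ι : X.carrier →ₗ[ℂ] E.carrier) : Prop where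
  isUCIS : IsUCIS X E ι
  isInjective : E.IsInjective
  eq_top : ∀ (F : Submodule ℂ E.carrier) (hF : E.one ∈ F),
    (∀ x, ι x ∈ F) → (E.sub F hF).IsInjective → F = ⊤

end UnitalOperatorSpace

section OperatorsOnH

variable {H : Type u} [NormedAddCommGroup H] [InnerProductSpace ℂ H] [CompleteSpace H]

/-- The quotient (semi)norm of `A + M_n(I)` in `M_n(B(H)) / M_n(I) = M_n(B(H)/I)`. -/
def quotientMatrixNorm (I : Submodule ℂ (H →L[ℂ] H)) (n : ℕ)
    (A : Matrix (Fin n) (Fin n) (H →L[ℂ] H)) : ℝ :=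
  sInf {r : ℝ | ∃ Y : Matrix (Fin n) (Fin n) (H →L[ℂ] H),
    (∀ i j, Y i j ∈ I) ∧ r = ‖blockOp (A + Y)‖}

/-- `I` is a boundary subsystem for `X` in `B(H)`: it is a selfadjoint linear subspace, and the
restriction to `X` of the quotient map `B(H) → B(H)/I` is completely isometric. -/
structure IsBoundarySubsystem (X I : Submodule ℂ (H →L[ℂ] H)) : Prop where
  star_mem : ∀ a ∈ I, star a ∈ I
  quotient_isometric : ∀ (n : ℕ) (A : Matrix (Fin n) (Fin n) (H →L[ℂ] H)),
    (∀ i j, A i j ∈ X) → quotientMatrixNorm I n A = ‖blockOp A‖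

/-- `X`-maps: ucc maps on `B(H)` that fix `X` elementwise. -/
structure IsXMap (X : Submodule ℂ (H →L[ℂ] H))
    (φ : (H →L[ℂ] H) →ₗ[ℂ] (H →L[ℂ] H)) : Prop where
  isUCC : UnitalOperatorSpace.IsUCC (UnitalOperatorSpace.boundedOps H)
    (UnitalOperatorSpace.boundedOps H) φ
  fixes : ∀ x ∈ X, φ x = x

/-- `X`-projections: idempotent `X`-maps. -/
structure IsXProjection (X : Submodule ℂ (H →L[ℂ] H))
    (φ : (H →L[ℂ] H) →ₗ[ℂ] (H →L[ℂ] H)) : Prop where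
  isXMap : IsXMap X φ
  idem : φ ∘ₗ φ = φ

theorem IsXProjection.one_mem_range {X : Submodule ℂ (H →L[ℂ] H)}
    {φ : (H →L[ℂ] H) →ₗ[ℂ] (H →L[ℂ] H)} (h : IsXProjection X φ) :
    (1 : H →L[ℂ] H) ∈ LinearMap.range φ :=
  ⟨1, h.isXMap.isUCC.map_one⟩

/-- The relation `ψ ≺ φ`. -/
structure XPrec (X : Submodule ℂ (H →L[ℂ] H))
    (ψ φ : (H →L[ℂ] H) →ₗ[ℂ] (H →L[ℂ] H)) : Prop where
  isXProjection : IsXProjection X ψ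
  comp_left : ψ ∘ₗ φ = ψ
  comp_right : φ ∘ₗ ψ = ψ

/-- `φ` is an `X`-projection that is minimal for `≺`. -/
def IsPrecMinimal (X : Submodule ℂ (H →L[ℂ] H))
    (φ : (H →L[ℂ] H) →ₗ[ℂ] (H →L[ℂ] H)) : Prop :=
  IsXProjection X φ ∧ ∀ ψ, XPrec X ψ φ → ψ = φ

/-- The matrix seminorms `p_{φ_n}([a_ij]) = ‖[φ(a_ij)]‖` attached to `φ`; the `X`-seminorm `p_φ`
is the one for `n = 1`. -/
def xSeminorm (φ : (H →L[ℂ] H) →ₗ[ℂ] (H →L[ℂ] H)) (n : ℕ)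
    (A : Matrix (Fin n) (Fin n) (H →L[ℂ] H)) : ℝ :=
  ‖blockOp (A.map φ)‖

/-- The relation `p_ψ ≤_c p_φ`. -/
structure XSeminormLE (X : Submodule ℂ (H →L[ℂ] H))
    (ψ φ : (H →L[ℂ] H) →ₗ[ℂ] (H →L[ℂ] H)) : Prop where
  isXMap : IsXMap X ψ
  le : ∀ (n : ℕ) (A : Matrix (Fin n) (Fin n) (H →L[ℂ] H)), xSeminorm ψ n A ≤ xSeminorm φ n A

/-- `φ` is an `X`-map whose `X`-seminorm is minimal for `≤_c`. -/
def IsXSeminormMinimal (X : Submodule ℂ (H →L[ℂ] H))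
    (φ : (H →L[ℂ] H) →ₗ[ℂ] (H →L[ℂ] H)) : Prop :=
  IsXMap X φ ∧ ∀ ψ, XSeminormLE X ψ φ → xSeminorm ψ = xSeminorm φ

end OperatorsOnH

end

-- Everything rests on the `X`-maps with minimal matrix seminorm. Below any `X`-map there is such a
-- minimal one: Zorn's lemma applies because a chain is bounded by a weak operator limit along an
-- ultrafilter (`exists_isXSeminormMinimal`). Averaging powers shows that a minimal `φ` is
-- idempotent, and the same argument applied to `φ ∘ ψ ∘ φ` gives rigidity: `φ ∘ ψ ∘ φ = φ` for
-- every `X`-map `ψ` (`IsXSeminormMinimal.rigid`). Rigidity yields both `≺`-minimality and the fact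
-- that the range of `φ` is an injective envelope.
--
-- Kernels of `X`-maps are boundary subsystems, and each boundary subsystem `I` lies in such a
-- kernel: `x + y ↦ x` is completely contractive on `X + I` and extends to `B(H)`. Hence a maximal
-- `I` is the kernel of a minimal `φ`. Conversely, a ucc map onto any injective envelope is compared
-- with one minimal `X`-map, and rigidity makes its kernel maximal.
--
-- The analytic input is the injectivity of `B(H)` (`exists_completelyContractive_extension`). It
-- follows from Hahn–Banach on the functionals `T ↦ ∑ ⟪η i, T (y i j) (ξ j)⟫`, with the seminorm
-- that charges such a functional half of `∑ ‖ξ i‖² + ∑ ‖η i‖²` when `y` is in the unit ball.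

universe v w

noncomputable section

/-! ### Matrix norms through sesquilinear forms -/

section Forms

variable {K : Type u} [NormedAddCommGroup K] [InnerProductSpace ℂ K]

/-- The scalar `∑ ⟪η i, T (y i j) (ξ j)⟫` attached to a matrix `y` and a `B(K)`-valued map `T`. -/
def matrixForm {Y : Type v} [AddCommGroup Y] [Module ℂ Y] {n : ℕ}
    (T : Y →ₗ[ℂ] (K →L[ℂ] K)) (y : Matrix (Fin n) (Fin n) Y) (ξ η : Fin n → K) : ℂ :=
  ∑ i, ∑ j, inner ℂ (η i) (T (y i j) (ξ j))

theorem inner_blockOp {n : ℕ} (A : Matrix (Fin n) (Fin n) (K →L[ℂ] K))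
    (a b : PiLp 2 (fun _ : Fin n => K)) :
    inner ℂ b (blockOp A a) = ∑ i, ∑ j, inner ℂ (b i) (A i j (a j)) := by
  simp [PiLp.inner_apply, blockOp_apply, inner_sum]

/-- Cauchy–Schwarz, then the arithmetic–geometric mean inequality. The additive bound is preferred
to the product because it adds up over block diagonal sums. -/
theorem norm_matrixForm_le {Y : Type v} [AddCommGroup Y] [Module ℂ Y] {n : ℕ}
    (T : Y →ₗ[ℂ] (K →L[ℂ] K)) (y : Matrix (Fin n) (Fin n) Y) (h : ‖blockOp (y.map T)‖ ≤ 1)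
    (ξ η : Fin n → K) :
    ‖matrixForm T y ξ η‖ ≤ ((∑ i, ‖ξ i‖ ^ 2) + ∑ i, ‖η i‖ ^ 2) / 2 := by
  have h1 := inner_blockOp (y.map T) (WithLp.toLp 2 ξ) (WithLp.toLp 2 η)
  have h2 : matrixForm T y ξ η =
      inner ℂ (WithLp.toLp 2 η) (blockOp (y.map T) (WithLp.toLp 2 ξ)) := by
    rw [h1]; rfl
  have e1 := PiLp.norm_sq_eq_of_L2 (fun _ : Fin n => K) (WithLp.toLp 2 ξ)
  have e2 := PiLp.norm_sq_eq_of_L2 (fun _ : Fin n => K) (WithLp.toLp 2 η)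
  simp only at e1 e2
  rw [h2, ← e1, ← e2]
  have h3 := norm_inner_le_norm (𝕜 := ℂ) (WithLp.toLp 2 η) (blockOp (y.map T) (WithLp.toLp 2 ξ))
  have h4 := (blockOp (y.map T)).le_of_opNorm_le h (WithLp.toLp 2 ξ)
  nlinarith [norm_nonneg (WithLp.toLp 2 η), norm_nonneg (WithLp.toLp 2 ξ),
    sq_nonneg (‖WithLp.toLp 2 η‖ - ‖WithLp.toLp 2 ξ‖)]

theorem norm_blockOp_le_of_inner {n : ℕ} (A : Matrix (Fin n) (Fin n) (K →L[ℂ] K)) {c : ℝ}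
    (hc : 0 ≤ c)
    (h : ∀ a b : PiLp 2 (fun _ : Fin n => K),
      ‖(inner ℂ b (blockOp A a) : ℂ)‖ ≤ c * ‖a‖ * ‖b‖) : ‖blockOp A‖ ≤ c := by
  refine ContinuousLinearMap.opNorm_le_bound _ hc fun a => ?_
  have h1 := h a (blockOp A a)
  rw [inner_self_eq_norm_sq_to_K] at h1
  simp only [norm_pow, RCLike.norm_ofReal, abs_norm] at h1
  rcases (norm_nonneg (blockOp A a)).eq_or_lt with h0 | h0
  · rw [← h0]; positivity
  · nlinarith

theorem norm_blockOp_le_one_of_matrixForm {Y : Type v} [AddCommGroup Y] [Module ℂ Y] {n : ℕ}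
    (T : Y →ₗ[ℂ] (K →L[ℂ] K)) (y : Matrix (Fin n) (Fin n) Y)
    (h : ∀ ξ η : Fin n → K,
      ‖matrixForm T y ξ η‖ ≤ ((∑ i, ‖ξ i‖ ^ 2) + ∑ i, ‖η i‖ ^ 2) / 2) :
    ‖blockOp (y.map T)‖ ≤ 1 := by
  refine ContinuousLinearMap.opNorm_le_bound _ zero_le_one fun a => ?_
  -- Testing with `η` the image of `a` gives `‖Ta‖² ≤ (‖a‖² + ‖Ta‖²) / 2`, so no rescaling is
  -- needed.
  have h1 := h a (blockOp (y.map T) a)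
  have h2 : matrixForm T y a (blockOp (y.map T) a) =
      inner ℂ (blockOp (y.map T) a) (blockOp (y.map T) a) := by
    rw [inner_blockOp]; rfl
  rw [h2, inner_self_eq_norm_sq_to_K, ← PiLp.norm_sq_eq_of_L2, ← PiLp.norm_sq_eq_of_L2] at h1
  simp only [norm_pow, RCLike.norm_ofReal, abs_norm] at h1
  rw [one_mul]
  exact abs_le_of_sq_le_sq' (by linarith) (norm_nonneg a) |>.2

theorem blockOp_add {n : ℕ} (A B : Matrix (Fin n) (Fin n) (K →L[ℂ] K)) :
    blockOp (A + B) = blockOp A + blockOp B := by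
  ext v i
  simp [blockOp_apply, Finset.sum_add_distrib]

theorem blockOp_smul {n : ℕ} (c : ℂ) (A : Matrix (Fin n) (Fin n) (K →L[ℂ] K)) :
    blockOp (c • A) = c • blockOp A := by
  ext v i
  simp [blockOp_apply, Finset.smul_sum]

theorem blockOp_zero {n : ℕ} : blockOp (0 : Matrix (Fin n) (Fin n) (K →L[ℂ] K)) = 0 := by
  ext v i
  simp [blockOp_apply]

theorem norm_blockOp_nonneg {n : ℕ} (A : Matrix (Fin n) (Fin n) (K →L[ℂ] K)) :
    0 ≤ ‖blockOp A‖ :=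
  ContinuousLinearMap.opNorm_nonneg _

theorem norm_blockOp_zero {n : ℕ} : ‖blockOp (0 : Matrix (Fin n) (Fin n) (K →L[ℂ] K))‖ = 0 := by
  rw [blockOp_zero]
  exact ContinuousLinearMap.opNorm_zero

theorem norm_blockOp_add_le {n : ℕ} (A B : Matrix (Fin n) (Fin n) (K →L[ℂ] K)) :
    ‖blockOp (A + B)‖ ≤ ‖blockOp A‖ + ‖blockOp B‖ := by
  rw [blockOp_add]
  exact ContinuousLinearMap.opNorm_add_le _ _

theorem norm_blockOp_smul_le {n : ℕ} (c : ℂ) (A : Matrix (Fin n) (Fin n) (K →L[ℂ] K)) :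
    ‖blockOp (c • A)‖ ≤ ‖c‖ * ‖blockOp A‖ := by
  rw [blockOp_smul]
  exact ContinuousLinearMap.opNorm_smul_le _ _

theorem norm_blockOp_smul {n : ℕ} (c : ℂ) (A : Matrix (Fin n) (Fin n) (K →L[ℂ] K)) :
    ‖blockOp (c • A)‖ = ‖c‖ * ‖blockOp A‖ := by
  refine le_antisymm (norm_blockOp_smul_le c A) ?_
  rcases eq_or_ne c 0 with rfl | hc
  · simpa using norm_blockOp_nonneg _
  · have h := norm_blockOp_smul_le c⁻¹ (c • A)
    rwa [inv_smul_smul₀ hc, norm_inv, ← div_eq_inv_mul, le_div_iff₀' (norm_pos_iff.mpr hc)] at h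

theorem norm_blockOp_sum_le {n : ℕ} {ι : Type*} (s : Finset ι)
    (A : ι → Matrix (Fin n) (Fin n) (K →L[ℂ] K)) :
    ‖blockOp (∑ k ∈ s, A k)‖ ≤ ∑ k ∈ s, ‖blockOp (A k)‖ := by
  classical
  induction s using Finset.induction_on with
  | empty => simp [norm_blockOp_zero]
  | insert a s ha ih =>
    rw [Finset.sum_insert ha, Finset.sum_insert ha]
    exact (norm_blockOp_add_le _ _).trans (by gcongr)

theorem norm_blockOp_scalar (a : K →L[ℂ] K) :
    ‖blockOp (Matrix.of fun _ _ => a : Matrix (Fin 1) (Fin 1) (K →L[ℂ] K))‖ = ‖a‖ := by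
  have hn : ∀ v : PiLp 2 (fun _ : Fin 1 => K), ‖v‖ = ‖v 0‖ := fun v => by
    rw [PiLp.norm_eq_of_L2]; simp
  refine le_antisymm ?_ ?_
  · refine ContinuousLinearMap.opNorm_le_bound _ (ContinuousLinearMap.opNorm_nonneg _) fun v => ?_
    rw [hn, hn v, blockOp_apply]
    simpa using a.le_opNorm (v 0)
  · refine ContinuousLinearMap.opNorm_le_bound _ (ContinuousLinearMap.opNorm_nonneg _) fun v => ?_
    have := (blockOp (Matrix.of fun _ _ => a : Matrix (Fin 1) (Fin 1) (K →L[ℂ] K))).le_opNorm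
      (WithLp.toLp 2 fun _ => v)
    rw [hn, hn (WithLp.toLp 2 fun _ => v), blockOp_apply] at this
    simpa using this

/-- Contractivity on the unit ball gives contractivity. -/
theorem norm_blockOp_map_le_of_unitBall {L : Type*} [NormedAddCommGroup L] [InnerProductSpace ℂ L]
    {Y : Type v} [AddCommGroup Y] [Module ℂ Y] (r : Y →ₗ[ℂ] (K →L[ℂ] K))
    (φ : Y →ₗ[ℂ] (L →L[ℂ] L)) {n : ℕ}
    (h : ∀ y : Matrix (Fin n) (Fin n) Y, ‖blockOp (y.map r)‖ ≤ 1 → ‖blockOp (y.map φ)‖ ≤ 1)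
    (y : Matrix (Fin n) (Fin n) Y) : ‖blockOp (y.map φ)‖ ≤ ‖blockOp (y.map r)‖ := by
  refine le_of_forall_gt_imp_ge_of_dense fun c hc => ?_
  have hc0 : 0 < c := (ContinuousLinearMap.opNorm_nonneg _).trans_lt hc
  have e1 : ((c⁻¹ : ℂ) • y).map r = (c⁻¹ : ℂ) • y.map r := by ext; simp
  have e2 : ((c⁻¹ : ℂ) • y).map φ = (c⁻¹ : ℂ) • y.map φ := by ext; simp
  have h1 := h ((c⁻¹ : ℂ) • y)
  rw [e1, e2, norm_blockOp_smul, norm_blockOp_smul, norm_inv, Complex.norm_real,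
    Real.norm_of_nonneg hc0.le, inv_mul_le_one₀ hc0, inv_mul_le_one₀ hc0] at h1
  exact h1 hc.le

end Forms

/-! ### Unitary rotation to orthogonal vectors, and masking -/

section Rotation

variable {H : Type u} [NormedAddCommGroup H] [InnerProductSpace ℂ H]

/-- Every finite family of vectors is a unitary rotation of an orthogonal family. -/
theorem exists_unitary_orthogonal {n : ℕ} (ξ : Fin n → H) :
    ∃ (V : Matrix (Fin n) (Fin n) ℂ) (a : Fin n → H), V.conjTranspose * V = 1 ∧
      (∀ j, ξ j = ∑ k, V j k • a k) ∧ ∀ k l, k ≠ l → inner ℂ (a k) (a l) = 0 := by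
  have hG := Matrix.isHermitian_gram (𝕜 := ℂ) ξ
  set C : Matrix (Fin n) (Fin n) ℂ := hG.eigenvectorUnitary.1 with hC
  have hC1 : C * C.conjTranspose = 1 := Unitary.mul_star_self_of_mem hG.eigenvectorUnitary.2
  have hC2 : C.conjTranspose * C = 1 := Unitary.star_mul_self_of_mem hG.eigenvectorUnitary.2
  -- The family `∑ i, C i k • ξ i` has this matrix as its Gram matrix; diagonality means
  -- orthogonality. Some of its vectors may vanish.
  have hD : C.conjTranspose * Matrix.gram ℂ ξ * C =
      Matrix.diagonal (RCLike.ofReal ∘ hG.eigenvalues) := by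
    conv_lhs => rw [hG.spectral_theorem, Unitary.conjStarAlgAut_apply]
    change C.conjTranspose * (C * _ * C.conjTranspose) * C = _
    rw [Matrix.mul_assoc, Matrix.mul_assoc C, Matrix.mul_assoc C, Matrix.mul_assoc _ _ C, hC2,
      ← Matrix.mul_assoc, hC2]
    simp
  refine ⟨C.map star, fun k => ∑ i, C i k • ξ i, ?_, fun j => ?_, fun k l hkl => ?_⟩
  · have : (C.map star).conjTranspose * C.map star = (C.conjTranspose * C).map star := by
      ext i j
      simp [Matrix.mul_apply]
    rw [this, hC2]
    ext i j
    simp [Matrix.one_apply, apply_ite]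
  · simp_rw [Finset.smul_sum, smul_smul]
    rw [Finset.sum_comm]
    simp_rw [← Finset.sum_smul]
    have : ∀ i, ∑ k, (C.map star) j k * C i k = (1 : Matrix (Fin n) (Fin n) ℂ) i j := fun i => by
      rw [← hC1, Matrix.mul_apply]
      simp [mul_comm]
    simp only [this]
    simp [Matrix.one_apply]
  · have := congrFun (congrFun hD k) l
    rw [Matrix.diagonal_apply_ne _ hkl] at this
    rw [← this]
    simp only [sum_inner, inner_sum, inner_smul_left, inner_smul_right, Matrix.mul_apply,
      Matrix.conjTranspose_apply, Matrix.gram_apply, Finset.sum_mul, Finset.mul_sum]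
    refine Finset.sum_congr rfl fun i _ => Finset.sum_congr rfl fun j _ => ?_
    simp only [RCLike.star_def]
    ring

theorem sum_norm_sq_rotation {n : ℕ} {V : Matrix (Fin n) (Fin n) ℂ}
    (hV : V.conjTranspose * V = 1) (a : Fin n → H) :
    ∑ j, ‖∑ k, V j k • a k‖ ^ 2 = ∑ k, ‖a k‖ ^ 2 := by
  have key : ∑ j, inner ℂ (∑ k, V j k • a k) (∑ k, V j k • a k) = ∑ k, inner ℂ (a k) (a k) := by
    simp only [sum_inner, inner_sum, inner_smul_left, inner_smul_right, Finset.mul_sum]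
    rw [Finset.sum_comm]
    refine Finset.sum_congr rfl fun k _ => ?_
    rw [Finset.sum_comm]
    have : ∀ l, ∑ j, V j k * ((starRingEnd ℂ) (V j l) * inner ℂ (a l) (a k)) =
        (1 : Matrix (Fin n) (Fin n) ℂ) l k * inner ℂ (a l) (a k) := fun l => by
      rw [← hV, Matrix.mul_apply, Finset.sum_mul]
      refine Finset.sum_congr rfl fun j _ => ?_
      simp only [Matrix.conjTranspose_apply, RCLike.star_def]
      ring
    simp [this, Matrix.one_apply]
  simp only [inner_self_eq_norm_sq_to_K] at key
  exact_mod_cast key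

variable {Y : Type v} [AddCommGroup Y] [Module ℂ Y]

/-- The matrix `Uᴴ y V` for scalar matrices `U` and `V`. -/
def rotateMatrix {n : ℕ} (U V : Matrix (Fin n) (Fin n) ℂ) (y : Matrix (Fin n) (Fin n) Y) :
    Matrix (Fin n) (Fin n) Y :=
  fun l k => ∑ i, ∑ j, (star (U i l) * V j k) • y i j

theorem matrixForm_rotate {n : ℕ} (T : Y →ₗ[ℂ] (H →L[ℂ] H)) (U V : Matrix (Fin n) (Fin n) ℂ)
    (y : Matrix (Fin n) (Fin n) Y) (a b : Fin n → H) :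
    matrixForm T (rotateMatrix U V y) a b =
      matrixForm T y (fun j => ∑ k, V j k • a k) (fun i => ∑ l, U i l • b l) := by
  simp only [matrixForm, rotateMatrix, map_sum, map_smul, sum_inner, inner_sum, inner_smul_left,
    inner_smul_right, sum_apply, smul_apply]
  calc _ = ∑ l, ∑ i, ∑ j, ∑ k, star (U i l) * V j k * inner ℂ (b l) (T (y i j) (a k)) := by
        refine Finset.sum_congr rfl fun l _ => ?_
        rw [Finset.sum_comm]
        refine Finset.sum_congr rfl fun i _ => ?_
        rw [Finset.sum_comm]
    _ = ∑ i, ∑ j, ∑ l, ∑ k, star (U i l) * V j k * inner ℂ (b l) (T (y i j) (a k)) := by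
        rw [Finset.sum_comm]
        refine Finset.sum_congr rfl fun i _ => ?_
        rw [Finset.sum_comm]
    _ = _ := by
        refine Finset.sum_congr rfl fun i _ => Finset.sum_congr rfl fun j _ => ?_
        rw [Finset.sum_comm]
        refine Finset.sum_congr rfl fun k _ => ?_
        rw [Finset.mul_sum]
        refine Finset.sum_congr rfl fun l _ => ?_
        simp only [RCLike.star_def]
        ring

/-- Replacing the entries in some rows and columns by zero. -/
def maskMatrix {n : ℕ} (p q : Fin n → Prop) [DecidablePred p] [DecidablePred q]
    (y : Matrix (Fin n) (Fin n) Y) : Matrix (Fin n) (Fin n) Y :=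
  fun l k => if p l ∧ q k then y l k else 0

theorem matrixForm_mask {n : ℕ} (T : Y →ₗ[ℂ] (H →L[ℂ] H)) (p q : Fin n → Prop)
    [DecidablePred p] [DecidablePred q] (y : Matrix (Fin n) (Fin n) Y) (a b : Fin n → H) :
    matrixForm T (maskMatrix p q y) a b =
      matrixForm T y (fun k => if q k then a k else 0) (fun l => if p l then b l else 0) := by
  refine Finset.sum_congr rfl fun l _ => Finset.sum_congr rfl fun k _ => ?_
  by_cases h1 : p l <;> by_cases h2 : q k <;> simp [maskMatrix, h1, h2]

omit [InnerProductSpace ℂ H] in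
theorem sum_norm_sq_mask_le {n : ℕ} (p : Fin n → Prop) [DecidablePred p] (a : Fin n → H) :
    ∑ k, ‖if p k then a k else 0‖ ^ 2 ≤ ∑ k, ‖a k‖ ^ 2 := by
  refine Finset.sum_le_sum fun k _ => ?_
  split_ifs <;> simp

end Rotation

/-! ### Evaluation functionals and their seminorm -/

section Extension

variable {K : Type u} [NormedAddCommGroup K] [InnerProductSpace ℂ K]
  {H : Type w} [NormedAddCommGroup H] [InnerProductSpace ℂ H]
  {Y : Type v} [AddCommGroup Y] [Module ℂ Y]

theorem norm_blockOp_rotate_le {n : ℕ} (r : Y →ₗ[ℂ] (K →L[ℂ] K)) {U V : Matrix (Fin n) (Fin n) ℂ}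
    (hU : U.conjTranspose * U = 1) (hV : V.conjTranspose * V = 1) (y : Matrix (Fin n) (Fin n) Y)
    (h : ‖blockOp (y.map r)‖ ≤ 1) : ‖blockOp ((rotateMatrix U V y).map r)‖ ≤ 1 := by
  refine norm_blockOp_le_one_of_matrixForm r _ fun ξ η => ?_
  rw [matrixForm_rotate, ← sum_norm_sq_rotation hV ξ, ← sum_norm_sq_rotation hU η]
  exact norm_matrixForm_le r y h _ _

theorem norm_blockOp_mask_le {n : ℕ} (r : Y →ₗ[ℂ] (K →L[ℂ] K)) (p q : Fin n → Prop)
    [DecidablePred p] [DecidablePred q] (y : Matrix (Fin n) (Fin n) Y)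
    (h : ‖blockOp (y.map r)‖ ≤ 1) : ‖blockOp ((maskMatrix p q y).map r)‖ ≤ 1 := by
  refine norm_blockOp_le_one_of_matrixForm r _ fun ξ η => ?_
  rw [matrixForm_mask]
  refine (norm_matrixForm_le r y h _ _).trans ?_
  linarith [sum_norm_sq_mask_le q ξ, sum_norm_sq_mask_le p η]

/-- Evaluation `T ↦ ∑ ⟪η i, T (y i j) (ξ j)⟫` as a functional on linear maps. -/
def evalForm {n : ℕ} (y : Matrix (Fin n) (Fin n) Y) (ξ η : Fin n → H) :
    Module.Dual ℂ (Y →ₗ[ℂ] (H →L[ℂ] H)) where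
  toFun T := matrixForm T y ξ η
  map_add' S T := by
    simp [matrixForm, Finset.sum_add_distrib]
  map_smul' c T := by
    simp [matrixForm, Finset.mul_sum]

theorem evalForm_apply {n : ℕ} (y : Matrix (Fin n) (Fin n) Y) (ξ η : Fin n → H)
    (T : Y →ₗ[ℂ] (H →L[ℂ] H)) : evalForm y ξ η T = matrixForm T y ξ η := rfl

/-- `u` is an evaluation functional at a matrix in the unit ball, with weight `t`. -/
def IsContractiveEval (r : Y →ₗ[ℂ] (K →L[ℂ] K)) (u : Module.Dual ℂ (Y →ₗ[ℂ] (H →L[ℂ] H)))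
    (t : ℝ) : Prop :=
  ∃ (n : ℕ) (y : Matrix (Fin n) (Fin n) Y) (ξ η : Fin n → H), ‖blockOp (y.map r)‖ ≤ 1 ∧
    u = evalForm y ξ η ∧ t = ((∑ i, ‖ξ i‖ ^ 2) + ∑ i, ‖η i‖ ^ 2) / 2

variable {r : Y →ₗ[ℂ] (K →L[ℂ] K)}

theorem IsContractiveEval.nonneg {u : Module.Dual ℂ (Y →ₗ[ℂ] (H →L[ℂ] H))} {t : ℝ}
    (h : IsContractiveEval r u t) : 0 ≤ t := by
  obtain ⟨n, y, ξ, η, -, -, rfl⟩ := h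
  positivity

theorem IsContractiveEval.zero :
    IsContractiveEval r (0 : Module.Dual ℂ (Y →ₗ[ℂ] (H →L[ℂ] H))) 0 := by
  refine ⟨0, 0, 0, 0, ?_, ?_, by simp⟩
  · refine norm_blockOp_le_one_of_matrixForm r _ fun ξ η => ?_
    simp [matrixForm]
  · ext T
    simp [evalForm_apply, matrixForm]

theorem IsContractiveEval.smul {u : Module.Dual ℂ (Y →ₗ[ℂ] (H →L[ℂ] H))} {t : ℝ}
    (h : IsContractiveEval r u t) (c : ℂ) : IsContractiveEval r (c • u) (‖c‖ * t) := by
  rcases eq_or_ne c 0 with rfl | hc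
  · simpa using IsContractiveEval.zero
  obtain ⟨n, y, ξ, η, hy, rfl, rfl⟩ := h
  have hs : 0 < √‖c‖ := Real.sqrt_pos.mpr (norm_pos_iff.mpr hc)
  -- Both factors of `c = (c / √‖c‖) · √‖c‖` have modulus `√‖c‖`, so both sums of squares scale by
  -- `‖c‖`.
  refine ⟨n, y, fun j => (c / (√‖c‖ : ℂ)) • ξ j, fun j => (√‖c‖ : ℂ) • η j, hy, ?_, ?_⟩
  · ext T
    simp only [LinearMap.smul_apply, evalForm_apply, matrixForm, smul_eq_mul, map_smul,
      inner_smul_left, inner_smul_right, Complex.conj_ofReal, Finset.mul_sum]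
    refine Finset.sum_congr rfl fun i _ => Finset.sum_congr rfl fun j _ => ?_
    rw [← mul_assoc, div_mul_cancel₀]
    exact_mod_cast hs.ne'
  · have h1 : ∀ j, ‖(c / (√‖c‖ : ℂ)) • ξ j‖ ^ 2 = ‖c‖ * ‖ξ j‖ ^ 2 := fun j => by
      rw [norm_smul, norm_div, Complex.norm_real, Real.norm_of_nonneg hs.le, mul_pow, div_pow,
        Real.sq_sqrt (norm_nonneg c), sq ‖c‖, mul_self_div_self]
    have h2 : ∀ j, ‖(√‖c‖ : ℂ) • η j‖ ^ 2 = ‖c‖ * ‖η j‖ ^ 2 := fun j => by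
      rw [norm_smul, Complex.norm_real, Real.norm_of_nonneg hs.le, mul_pow,
        Real.sq_sqrt (norm_nonneg c)]
    simp only [h1, h2, ← Finset.mul_sum]
    ring

/-- The block diagonal matrix with two given blocks. -/
def blockSum {m n : ℕ} (y : Matrix (Fin m) (Fin m) Y) (z : Matrix (Fin n) (Fin n) Y) :
    Matrix (Fin (m + n)) (Fin (m + n)) Y :=
  Fin.addCases (fun i => Fin.addCases (fun j => y i j) fun _ => 0)
    fun i => Fin.addCases (fun _ => 0) fun j => z i j

theorem matrixForm_blockSum {m n : ℕ} (T : Y →ₗ[ℂ] (H →L[ℂ] H)) (y : Matrix (Fin m) (Fin m) Y)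
    (z : Matrix (Fin n) (Fin n) Y) (ξ η : Fin (m + n) → H) :
    matrixForm T (blockSum y z) ξ η =
      matrixForm T y (fun i => ξ (Fin.castAdd n i)) (fun i => η (Fin.castAdd n i)) +
        matrixForm T z (fun i => ξ (Fin.natAdd m i)) fun i => η (Fin.natAdd m i) := by
  simp [matrixForm, Fin.sum_univ_add, blockSum]

/-- A block diagonal sum of contractive matrices is contractive, and concatenating the vectors adds
the weights. This gives subadditivity of the seminorm. -/
theorem IsContractiveEval.add {u v : Module.Dual ℂ (Y →ₗ[ℂ] (H →L[ℂ] H))} {s t : ℝ}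
    (hu : IsContractiveEval r u s) (hv : IsContractiveEval r v t) :
    IsContractiveEval r (u + v) (s + t) := by
  obtain ⟨m, y, ξ, η, hy, rfl, rfl⟩ := hu
  obtain ⟨n, z, ξ', η', hz, rfl, rfl⟩ := hv
  refine ⟨m + n, blockSum y z, Fin.addCases ξ ξ', Fin.addCases η η', ?_, ?_, ?_⟩
  · refine norm_blockOp_le_one_of_matrixForm r _ fun a b => ?_
    rw [matrixForm_blockSum, Fin.sum_univ_add, Fin.sum_univ_add]
    refine (norm_add_le _ _).trans ?_
    have h1 := norm_matrixForm_le r y hy (fun i => a (Fin.castAdd n i)) fun i => b (Fin.castAdd n i)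
    have h2 := norm_matrixForm_le r z hz (fun i => a (Fin.natAdd m i)) fun i => b (Fin.natAdd m i)
    linarith
  · ext T
    simp [evalForm_apply, matrixForm_blockSum]
  · simp only [Fin.sum_univ_add, Fin.addCases_left, Fin.addCases_right]
    ring

theorem isContractiveEval_scalar (r : Y →ₗ[ℂ] (K →L[ℂ] K)) (y : Y) (ξ η : H) :
    IsContractiveEval r (evalForm (Matrix.of fun _ _ : Fin 1 => y) (fun _ => ξ) (fun _ => η))
      (((‖r y‖ + 1) ^ 2 * ‖ξ‖ ^ 2 + ‖η‖ ^ 2) / 2) := by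
  -- The added `1` keeps the divisor positive when `r y = 0`.
  set c : ℝ := ‖r y‖ + 1 with hc
  have hc0 : 0 < c := by positivity
  refine ⟨1, Matrix.of fun _ _ => (c⁻¹ : ℂ) • y, fun _ => (c : ℂ) • ξ, fun _ => η, ?_, ?_, ?_⟩
  · have : (Matrix.of fun _ _ : Fin 1 => (c⁻¹ : ℂ) • y).map r =
        Matrix.of fun _ _ : Fin 1 => (c⁻¹ : ℂ) • r y := by ext; simp
    rw [this, norm_blockOp_scalar, norm_smul, norm_inv, Complex.norm_real,
      Real.norm_of_nonneg hc0.le, inv_mul_le_one₀ hc0]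
    linarith
  · have : (c : ℂ) ≠ 0 := by exact_mod_cast hc0.ne'
    ext T
    simp [evalForm_apply, matrixForm, this]
  · simp [norm_smul, mul_pow]

/-- The main estimate: an evaluation functional that only depends on the restriction of linear maps
to `Z` can be bounded at maps which are completely contractive on `Z` only. -/
theorem IsContractiveEval.norm_apply_le {u : Module.Dual ℂ (Y →ₗ[ℂ] (H →L[ℂ] H))} {t : ℝ}
    (h : IsContractiveEval r u t) (Z : Submodule ℂ Y) (φ : Y →ₗ[ℂ] (H →L[ℂ] H))
    (hφ : ∀ (n : ℕ) (y : Matrix (Fin n) (Fin n) Y), (∀ i j, y i j ∈ Z) →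
      ‖blockOp (y.map φ)‖ ≤ ‖blockOp (y.map r)‖)
    (hu : ∀ T : Y →ₗ[ℂ] (H →L[ℂ] H), (∀ z ∈ Z, T z = 0) → u T = 0) : ‖u φ‖ ≤ t := by
  classical
  obtain ⟨n, y, ξ, η, hy, rfl, rfl⟩ := h
  obtain ⟨V, a, hV, hξ, ha⟩ := exists_unitary_orthogonal ξ
  obtain ⟨U, b, hU, hη, hb⟩ := exists_unitary_orthogonal η
  obtain rfl : ξ = fun j => ∑ k, V j k • a k := funext hξ
  obtain rfl : η = fun j => ∑ k, U j k • b k := funext hη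
  -- Entries paired with a zero vector contribute nothing, and the hypothesis on `u` says nothing
  -- about them, so they are erased.
  set y' := maskMatrix (fun l => b l ≠ 0) (fun k => a k ≠ 0) (rotateMatrix U V y) with hy'
  have ha' : (fun k => if a k ≠ 0 then a k else 0) = a := by
    ext k
    by_cases h : a k = 0 <;> simp [h]
  have hb' : (fun k => if b k ≠ 0 then b k else 0) = b := by
    ext k
    by_cases h : b k = 0 <;> simp [h]
  have hT : ∀ T : Y →ₗ[ℂ] (H →L[ℂ] H), matrixForm T y' a b =
      evalForm y (fun j => ∑ k, V j k • a k) (fun j => ∑ k, U j k • b k) T := fun T => by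
    rw [evalForm_apply, ← matrixForm_rotate, hy', matrixForm_mask, ha', hb']
  have hy1 : ‖blockOp (y'.map r)‖ ≤ 1 :=
    norm_blockOp_mask_le r _ _ _ (norm_blockOp_rotate_le r hU hV y hy)
  have hZ : ∀ l k, y' l k ∈ Z := fun l k => by
    by_contra hlk
    have hne : b l ≠ 0 ∧ a k ≠ 0 := by
      by_contra hcon
      refine hlk ?_
      rw [hy', maskMatrix, if_neg hcon]
      exact Z.zero_mem
    obtain ⟨f, hf, hfZ⟩ := Submodule.exists_le_ker_of_notMem hlk
    -- The rank one map built from `b l` and `a k` vanishes on `Z`. By orthogonality it isolates the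
    -- entry `(l, k)`, leaving a nonzero multiple of `f (y' l k)`.
    have h0 := hu (f.smulRight (InnerProductSpace.rankOne ℂ (b l) (a k))) fun z hz => by
      have : f z = 0 := hfZ hz
      simp [this]
    rw [← hT, matrixForm, Finset.sum_eq_single l, Finset.sum_eq_single k] at h0
    · simp [hf, hne.1, hne.2] at h0
    · intro j _ hj
      simp [ha k j hj.symm]
    · simp
    · intro i _ hi
      refine Finset.sum_eq_zero fun j _ => ?_
      simp [hb i l hi]
    · simp
  rw [← hT, sum_norm_sq_rotation hV, sum_norm_sq_rotation hU]
  exact norm_matrixForm_le φ y' ((hφ n y' hZ).trans hy1) a b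

/-- The space of all evaluation functionals. -/
def evalSubmodule (r : Y →ₗ[ℂ] (K →L[ℂ] K)) (H : Type w) [NormedAddCommGroup H]
    [InnerProductSpace ℂ H] : Submodule ℂ (Module.Dual ℂ (Y →ₗ[ℂ] (H →L[ℂ] H))) where
  carrier := {u | ∃ t, IsContractiveEval r u t}
  add_mem' := fun ⟨_, hs⟩ ⟨_, ht⟩ => ⟨_, hs.add ht⟩
  zero_mem' := ⟨_, IsContractiveEval.zero⟩
  smul_mem' c _ := fun ⟨_, ht⟩ => ⟨_, ht.smul c⟩

theorem bddBelow_isContractiveEval (u : Module.Dual ℂ (Y →ₗ[ℂ] (H →L[ℂ] H))) :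
    BddBelow {t | IsContractiveEval r u t} :=
  ⟨0, fun _ h => h.nonneg⟩

/-- The infimum of the weights of the representations of an evaluation functional. -/
def evalSeminorm (r : Y →ₗ[ℂ] (K →L[ℂ] K)) (H : Type w) [NormedAddCommGroup H]
    [InnerProductSpace ℂ H] : Seminorm ℂ (evalSubmodule r H) :=
  Seminorm.ofSMulLE (fun u => sInf {t | IsContractiveEval r u.1 t})
    (le_antisymm (csInf_le (bddBelow_isContractiveEval _) IsContractiveEval.zero)
      (Real.sInf_nonneg fun _ h => h.nonneg))
    (fun u v => by
      refine le_of_forall_pos_le_add fun ε hε => ?_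
      obtain ⟨s, hs, hs'⟩ := Real.lt_sInf_add_pos u.2 (half_pos hε)
      obtain ⟨t, ht, ht'⟩ := Real.lt_sInf_add_pos v.2 (half_pos hε)
      refine (csInf_le (bddBelow_isContractiveEval _) (IsContractiveEval.add hs ht)).trans ?_
      change s < sInf {t | IsContractiveEval r u.1 t} + ε / 2 at hs'
      change t < sInf {t | IsContractiveEval r v.1 t} + ε / 2 at ht'
      linarith)
    (fun c u => by
      rw [← smul_eq_mul, ← Real.sInf_smul_of_nonneg (norm_nonneg c)]
      refine le_csInf (Set.Nonempty.smul_set u.2) ?_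
      rintro _ ⟨t, ht, rfl⟩
      exact csInf_le (bddBelow_isContractiveEval _) (ht.smul c))

theorem evalSeminorm_le {t : ℝ} (u : evalSubmodule r H) (h : IsContractiveEval r u.1 t) :
    evalSeminorm r H u ≤ t :=
  csInf_le (bddBelow_isContractiveEval _) h

end Extension

/-! ### Weak limits and the extension theorem -/

section Limits

open Filter Topology

variable {H : Type w} [NormedAddCommGroup H] [InnerProductSpace ℂ H] [CompleteSpace H]
  {Y : Type v} [AddCommGroup Y] [Module ℂ Y]

/-- A bounded sesquilinear form depending linearly on a parameter comes from a linear map into the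
bounded operators. -/
theorem exists_linearMap_of_form (G : Y → H → H → ℂ)
    (hadd : ∀ y y' ξ η, G (y + y') ξ η = G y ξ η + G y' ξ η)
    (hsmul : ∀ (c : ℂ) y ξ η, G (c • y) ξ η = c * G y ξ η)
    (hadd₁ : ∀ y ξ ξ' η, G y (ξ + ξ') η = G y ξ η + G y ξ' η)
    (hsmul₁ : ∀ (c : ℂ) y ξ η, G y (c • ξ) η = c * G y ξ η)
    (hadd₂ : ∀ y ξ η η', G y ξ (η + η') = G y ξ η + G y ξ η')
    (hsmul₂ : ∀ (c : ℂ) y ξ η, G y ξ (c • η) = star c * G y ξ η)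
    (C : Y → ℝ) (hG : ∀ y ξ η, ‖ξ‖ = 1 → ‖η‖ = 1 → ‖G y ξ η‖ ≤ C y) :
    ∃ Ψ : Y →ₗ[ℂ] (H →L[ℂ] H), ∀ y ξ η, inner ℂ η (Ψ y ξ) = G y ξ η := by
  have hbound : ∀ y ξ η, ‖G y ξ η‖ ≤ C y * ‖ξ‖ * ‖η‖ := fun y ξ η => by
    rcases eq_or_ne ξ 0 with rfl | hξ
    · have := hsmul₁ 0 y 0 η
      simp only [zero_smul, zero_mul] at this
      simp [this]
    rcases eq_or_ne η 0 with rfl | hη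
    · have := hsmul₂ 0 y ξ 0
      simp only [zero_smul, star_zero, zero_mul] at this
      simp [this]
    have hξ' : (‖ξ‖ : ℂ) ≠ 0 := by simpa using hξ
    have hη' : (‖η‖ : ℂ) ≠ 0 := by simpa using hη
    have e : G y ξ η =
        (‖ξ‖ : ℂ) * ((‖η‖ : ℂ) * G y ((‖ξ‖ : ℂ)⁻¹ • ξ) ((‖η‖ : ℂ)⁻¹ • η)) := by
      rw [hsmul₁, hsmul₂]
      simp only [RCLike.star_def, map_inv₀, Complex.conj_ofReal]
      field_simp
    have h1 := hG y ((‖ξ‖ : ℂ)⁻¹ • ξ) ((‖η‖ : ℂ)⁻¹ • η) (norm_smul_inv_norm hξ)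
      (norm_smul_inv_norm hη)
    rw [e, norm_mul, norm_mul, Complex.norm_real, Complex.norm_real, norm_norm, norm_norm]
    calc _ ≤ ‖ξ‖ * (‖η‖ * C y) := by gcongr
      _ = _ := by ring
  let B : Y → H →L⋆[ℂ] H →L[ℂ] ℂ := fun y =>
    LinearMap.mkContinuous₂ (LinearMap.mk₂'ₛₗ (starRingEnd ℂ) (RingHom.id ℂ)
      (fun ξ η => star (G y ξ η)) (fun ξ ξ' η => by simp [hadd₁])
      (fun c ξ η => by simp [hsmul₁]) (fun ξ η η' => by simp [hadd₂])
      (fun c ξ η => by simp [hsmul₂])) (C y) fun ξ η => by simpa using hbound y ξ η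
  have hB : ∀ y ξ η, inner ℂ η (InnerProductSpace.continuousLinearMapOfBilin (B y) ξ) =
      G y ξ η := fun y ξ η => by
    rw [← inner_conj_symm, InnerProductSpace.continuousLinearMapOfBilin_apply]
    simp [B]
  refine ⟨{ toFun := fun y => InnerProductSpace.continuousLinearMapOfBilin (B y)
            map_add' := fun y y' => ?_
            map_smul' := fun c y => ?_ }, hB⟩
  · ext ξ
    refine ext_inner_left ℂ fun η => ?_
    rw [add_apply, inner_add_right, hB, hB, hB, hadd]
  · ext ξ
    refine ext_inner_left ℂ fun η => ?_
    rw [RingHom.id_apply, smul_apply, inner_smul_right, hB, hB, hsmul]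

/-- Pointwise weak limits along an ultrafilter of pointwise bounded families of linear maps. -/
theorem exists_ultrafilter_weakLimit {ι : Type*} (𝒰 : Ultrafilter ι)
    (φ : ι → Y →ₗ[ℂ] (H →L[ℂ] H)) (C : Y → ℝ) (hC : ∀ i y, ‖φ i y‖ ≤ C y) :
    ∃ Ψ : Y →ₗ[ℂ] (H →L[ℂ] H), ∀ y ξ η,
      Tendsto (fun i => inner ℂ η (φ i y ξ)) 𝒰 (𝓝 (inner ℂ η (Ψ y ξ))) := by
  have hbd : ∀ i y ξ η, ‖(inner ℂ η (φ i y ξ) : ℂ)‖ ≤ ‖η‖ * (C y * ‖ξ‖) := fun i y ξ η =>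
    (norm_inner_le_norm _ _).trans (by gcongr; exact (φ i y).le_of_opNorm_le (hC i y) ξ)
  have hlim : ∀ y ξ η, ∃ z : ℂ, Tendsto (fun i => (inner ℂ η (φ i y ξ) : ℂ)) 𝒰 (𝓝 z) :=
    fun y ξ η => by
      -- Closed discs in `ℂ` are compact, so a bounded family of scalars converges along any
      -- ultrafilter.
      obtain ⟨z, -, hz⟩ := (isCompact_closedBall (0 : ℂ) (‖η‖ * (C y * ‖ξ‖))).ultrafilter_le_nhds
        (𝒰.map fun i => inner ℂ η (φ i y ξ)) (by
          rw [le_principal_iff]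
          exact mem_map.mpr (Filter.univ_mem' fun i => by simpa using hbd i y ξ η))
      exact ⟨z, hz⟩
  choose G hG using hlim
  obtain ⟨Ψ, hΨ⟩ := exists_linearMap_of_form G
    (fun y y' ξ η => tendsto_nhds_unique (hG _ _ _)
      (((hG y ξ η).add (hG y' ξ η)).congr fun i => by simp))
    (fun c y ξ η => tendsto_nhds_unique (hG _ _ _)
      (((hG y ξ η).const_mul c).congr fun i => by simp))
    (fun y ξ ξ' η => tendsto_nhds_unique (hG _ _ _)
      (((hG y ξ η).add (hG y ξ' η)).congr fun i => by simp))
    (fun c y ξ η => tendsto_nhds_unique (hG _ _ _)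
      (((hG y ξ η).const_mul c).congr fun i => by simp))
    (fun y ξ η η' => tendsto_nhds_unique (hG _ _ _)
      (((hG y ξ η).add (hG y ξ η')).congr fun i => by simp))
    (fun c y ξ η => tendsto_nhds_unique (hG _ _ _)
      (((hG y ξ η).const_mul (star c)).congr fun i => by simp [mul_comm]))
    C (fun y ξ η hξ hη => le_of_tendsto (hG y ξ η).norm (.of_forall fun i => by
      simpa [hξ, hη] using hbd i y ξ η))
  exact ⟨Ψ, fun y ξ η => by rw [hΨ]; exact hG y ξ η⟩

omit [CompleteSpace H] in
theorem norm_blockOp_le_of_weakLimit {ι : Type*} (l : Filter ι) [l.NeBot]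
    (φ : ι → Y →ₗ[ℂ] (H →L[ℂ] H)) (Ψ : Y →ₗ[ℂ] (H →L[ℂ] H))
    (hΨ : ∀ y ξ η, Tendsto (fun i => inner ℂ η (φ i y ξ)) l (𝓝 (inner ℂ η (Ψ y ξ))))
    {n : ℕ} (y : Matrix (Fin n) (Fin n) Y) {c : ℝ}
    (h : ∀ᶠ i in l, ‖blockOp (y.map (φ i))‖ ≤ c) : ‖blockOp (y.map Ψ)‖ ≤ c := by
  obtain ⟨i, hi⟩ := h.exists
  refine norm_blockOp_le_of_inner _ ((norm_blockOp_nonneg _).trans hi) fun a b => ?_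
  have ht : Tendsto (fun i => inner ℂ b (blockOp (y.map (φ i)) a)) l
      (𝓝 (inner ℂ b (blockOp (y.map Ψ) a))) := by
    simp only [inner_blockOp, Matrix.map_apply]
    exact tendsto_finsetSum _ fun i _ => tendsto_finsetSum _ fun j _ => hΨ _ _ _
  refine le_of_tendsto ht.norm (h.mono fun i hi => ?_)
  calc _ ≤ ‖b‖ * ‖blockOp (y.map (φ i)) a‖ := norm_inner_le_norm _ _
    _ ≤ ‖b‖ * (c * ‖a‖) := by
      gcongr
      exact (blockOp (y.map (φ i))).le_of_opNorm_le hi a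
    _ = _ := by ring

/-- Extension of complete contractions into `B(H)` (Wittstock). -/
theorem exists_completelyContractive_extension {K : Type u} [NormedAddCommGroup K]
    [InnerProductSpace ℂ K] (r : Y →ₗ[ℂ] (K →L[ℂ] K)) (Z : Submodule ℂ Y)
    (φ : Y →ₗ[ℂ] (H →L[ℂ] H))
    (hφ : ∀ (n : ℕ) (y : Matrix (Fin n) (Fin n) Y), (∀ i j, y i j ∈ Z) →
      ‖blockOp (y.map φ)‖ ≤ ‖blockOp (y.map r)‖) :
    ∃ Ψ : Y →ₗ[ℂ] (H →L[ℂ] H),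
      (∀ (n : ℕ) (y : Matrix (Fin n) (Fin n) Y),
        ‖blockOp (y.map Ψ)‖ ≤ ‖blockOp (y.map r)‖) ∧ ∀ z ∈ Z, Ψ z = φ z := by
  -- Functionals that see only the restriction to `Z`. On them, evaluation at `φ` is dominated by
  -- the seminorm, although `φ` is uncontrolled off `Z`.
  let S : Submodule ℂ (evalSubmodule r H) :=
    { carrier := {u | ∀ T : Y →ₗ[ℂ] (H →L[ℂ] H), (∀ z ∈ Z, T z = 0) → u.1 T = 0}
      add_mem' := fun hu hv T hT => by simp [hu T hT, hv T hT]
      zero_mem' := fun T hT => by simp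
      smul_mem' := fun c u hu T hT => by simp [hu T hT] }
  let f : Module.Dual ℂ S :=
    LinearMap.applyₗ φ ∘ₗ (evalSubmodule r H).subtype ∘ₗ S.subtype
  obtain ⟨g, hgf, hg⟩ := Module.Dual.exists_extension_of_le_seminorm S f (p := evalSeminorm r H)
    fun u => le_csInf u.1.2 fun t ht => ht.norm_apply_le Z φ hφ u.2
  let e : Y → H → H → evalSubmodule r H := fun y ξ η =>
    ⟨evalForm (Matrix.of fun _ _ : Fin 1 => y) (fun _ => ξ) (fun _ => η),
      _, isContractiveEval_scalar r y ξ η⟩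
  have he : ∀ y ξ η T, (e y ξ η).1 T = inner ℂ η (T y ξ) := fun y ξ η T => by
    simp [e, evalForm_apply, matrixForm]
  have hext : ∀ {u v : evalSubmodule r H}, (∀ T, u.1 T = v.1 T) → u = v :=
    fun h => Subtype.ext (LinearMap.ext h)
  obtain ⟨Ψ, hΨ⟩ := exists_linearMap_of_form (fun y ξ η => g (e y ξ η))
    (fun y y' ξ η => by rw [← map_add]; exact congrArg g (hext fun T => by simp [he]))
    (fun c y ξ η => by
      rw [← smul_eq_mul, ← map_smul]; exact congrArg g (hext fun T => by simp [he]))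
    (fun y ξ ξ' η => by
      rw [← map_add]; exact congrArg g (hext fun T => by simp [he]))
    (fun c y ξ η => by
      rw [← smul_eq_mul, ← map_smul]
      exact congrArg g (hext fun T => by simp [he]))
    (fun y ξ η η' => by
      rw [← map_add]; exact congrArg g (hext fun T => by simp [he]))
    (fun c y ξ η => by
      rw [← smul_eq_mul, ← map_smul]
      exact congrArg g (hext fun T => by simp [he, mul_comm]))
    (fun y => ((‖r y‖ + 1) ^ 2 + 1) / 2)
    (fun y ξ η hξ hη => (hg _).trans ((evalSeminorm_le _
      (isContractiveEval_scalar r y ξ η)).trans (by simp [hξ, hη])))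
  refine ⟨Ψ, fun n => norm_blockOp_map_le_of_unitBall r Ψ fun y hy => ?_, fun z hz => ?_⟩
  · refine norm_blockOp_le_one_of_matrixForm Ψ y fun ξ η => ?_
    have hrep : IsContractiveEval r (evalForm y ξ η) _ := ⟨n, y, ξ, η, hy, rfl, rfl⟩
    -- The functional of a matrix is the sum of the functionals of its entries, so the single bound
    -- on `g` controls all matrix levels.
    have : matrixForm Ψ y ξ η = g ⟨evalForm y ξ η, _, hrep⟩ := by
      simp only [matrixForm, hΨ, ← map_sum]
      refine congrArg g (hext fun T => ?_)
      simp [evalForm_apply, matrixForm, he]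
    rw [this]
    exact (hg _).trans (evalSeminorm_le _ hrep)
  · ext ξ
    refine ext_inner_left ℂ fun η => ?_
    have hS : e z ξ η ∈ S := fun T hT => by simp [he, hT z hz]
    rw [hΨ]
    exact (hgf ⟨e z ξ η, hS⟩).trans (he z ξ η φ)

end Limits

/-! ### Existence of minimal seminorms -/

section MinimalSeminorm

open Filter

variable {H : Type u} [NormedAddCommGroup H] [InnerProductSpace ℂ H] [CompleteSpace H]

theorem IsXMap.norm_le {X : Submodule ℂ (H →L[ℂ] H)} {φ : (H →L[ℂ] H) →ₗ[ℂ] (H →L[ℂ] H)}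
    (hφ : IsXMap X φ) (a : H →L[ℂ] H) : ‖φ a‖ ≤ ‖a‖ := by
  have := hφ.isUCC.mnorm_le 1 (Matrix.of fun _ _ => a)
  rw [show (Matrix.of fun _ _ : Fin 1 => a).map φ = Matrix.of fun _ _ => φ a by ext; simp] at this
  simpa only [norm_blockOp_scalar] using this

theorem exists_isXSeminormMinimal {X : Submodule ℂ (H →L[ℂ] H)}
    {φ₀ : (H →L[ℂ] H) →ₗ[ℂ] (H →L[ℂ] H)} (hφ₀ : IsXMap X φ₀) :
    ∃ φ, IsXSeminormMinimal X φ ∧ XSeminormLE X φ φ₀ := by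
  let P := {φ : (H →L[ℂ] H) →ₗ[ℂ] (H →L[ℂ] H) // XSeminormLE X φ φ₀}
  let R : P → P → Prop := fun φ ψ => ∀ n A, xSeminorm ψ.1 n A ≤ xSeminorm φ.1 n A
  have htrans : ∀ {a b c : P}, R a b → R b c → R a c :=
    fun hab hbc n A => (hbc n A).trans (hab n A)
  suffices hzorn : ∀ c, IsChain R c → ∃ ub, ∀ a ∈ c, R a ub by
    obtain ⟨m, hm⟩ := exists_maximal_of_chains_bounded hzorn htrans
    refine ⟨m.1, ⟨m.2.isXMap, fun ψ hψ => ?_⟩, m.2⟩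
    have h1 : XSeminormLE X ψ φ₀ := ⟨hψ.isXMap, fun n A => (hψ.le n A).trans (m.2.le n A)⟩
    exact funext fun n => funext fun A => le_antisymm (hψ.le n A) (hm ⟨ψ, h1⟩ hψ.le n A)
  intro c hc
  have : Std.Refl R := ⟨fun _ _ _ => le_rfl⟩
  rcases c.eq_empty_or_nonempty with rfl | hne
  · exact ⟨⟨φ₀, hφ₀, fun _ _ => le_rfl⟩, fun a ha => ha.elim⟩
  have : Nonempty c := hne.to_subtype
  -- The filter of tails of the chain, so that the limit lies below every member.
  let F : Filter c := ⨅ a : c, 𝓟 {b : c | R a.1 b.1}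
  have hF : F.NeBot := by
    refine iInf_neBot_of_directed (fun a b => ?_) fun a =>
      principal_neBot_iff.mpr ⟨a, fun _ _ => le_rfl⟩
    rcases hc.total (r := fun x y => R x y) a.2 b.2 with hab | hba
    · exact ⟨b, principal_mono.mpr fun x hx => htrans hab hx, le_rfl⟩
    · exact ⟨a, le_rfl, principal_mono.mpr fun x hx => htrans hba hx⟩
  let 𝒰 : Ultrafilter c := Ultrafilter.of F
  have h𝒰 : ∀ a : c, ∀ᶠ b in (𝒰 : Filter c), R a.1 b.1 := fun a =>
    Ultrafilter.of_le F (iInf_le (fun a : c => 𝓟 {b : c | R a.1 b.1}) a (mem_principal_self _))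
  obtain ⟨Ψ, hΨ⟩ := exists_ultrafilter_weakLimit 𝒰 (fun b : c => b.1.1) (fun a => ‖a‖)
    fun b a => b.1.2.isXMap.norm_le a
  have hfix : ∀ a, (∀ b : c, b.1.1 a = a) → Ψ a = a := fun a ha => by
    ext ξ
    refine ext_inner_left ℂ fun η => tendsto_nhds_unique (hΨ a ξ η) ?_
    simp only [ha]
    exact tendsto_const_nhds
  have hle : ∀ a : c, ∀ n A, xSeminorm Ψ n A ≤ xSeminorm a.1.1 n A := fun a n A =>
    norm_blockOp_le_of_weakLimit _ _ Ψ hΨ A ((h𝒰 a).mono fun b hb => hb n A)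
  obtain ⟨a₀, ha₀⟩ := hne
  have hX : IsXMap X Ψ :=
    ⟨⟨hfix 1 fun b => b.1.2.isXMap.isUCC.map_one, fun n A =>
      (hle ⟨a₀, ha₀⟩ n A).trans (a₀.2.isXMap.isUCC.mnorm_le n A)⟩,
      fun x hx => hfix x fun b => b.1.2.isXMap.fixes x hx⟩
  exact ⟨⟨Ψ, hX, fun n A => (hle ⟨a₀, ha₀⟩ n A).trans (a₀.2.le n A)⟩,
    fun a ha n A => hle ⟨a, ha⟩ n A⟩

end MinimalSeminorm

/-! ### Injectivity of unital operator spaces -/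

namespace UnitalOperatorSpace

variable {E F G : UnitalOperatorSpace.{u}}

theorem IsUCC.comp {g : F.carrier →ₗ[ℂ] G.carrier} {f : E.carrier →ₗ[ℂ] F.carrier}
    (hg : IsUCC F G g) (hf : IsUCC E F f) : IsUCC E G (g ∘ₗ f) :=
  ⟨by simp [hf.map_one, hg.map_one],
    fun n A => (hg.mnorm_le n (A.map f)).trans (hf.mnorm_le n A)⟩

theorem IsUCIS.isUCC {f : E.carrier →ₗ[ℂ] F.carrier} (hf : IsUCIS E F f) : IsUCC E F f :=
  ⟨hf.map_one, fun n A => (hf.mnorm_eq n A).le⟩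

theorem isUCC_id : IsUCC E E LinearMap.id := ⟨rfl, fun _ _ => le_rfl⟩

theorem isUCIS_subtype (Z : Submodule ℂ E.carrier) (hZ : E.one ∈ Z) :
    IsUCIS (E.sub Z hZ) E Z.subtype := ⟨rfl, fun _ _ => rfl⟩

theorem IsUCC.codRestrict {f : E.carrier →ₗ[ℂ] F.carrier} (hf : IsUCC E F f)
    (Z : Submodule ℂ F.carrier) (hZ : F.one ∈ Z) (h : ∀ x, f x ∈ Z) :
    IsUCC E (F.sub Z hZ) (f.codRestrict Z h) :=
  ⟨Subtype.ext hf.map_one, fun n A => hf.mnorm_le n A⟩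

theorem IsUCIS.injective {f : E.carrier →ₗ[ℂ] F.carrier} (hf : IsUCIS E F f) :
    Function.Injective f := by
  refine (injective_iff_map_eq_zero f).mpr fun x hx => ?_
  have h := hf.mnorm_eq 1 (Matrix.of fun _ _ => x)
  obtain ⟨K, i₁, i₂, i₃, r, hr, -, hn⟩ := E.exists_realization
  obtain ⟨L, j₁, j₂, j₃, s, -, -, hm⟩ := F.exists_realization
  rw [← hn, ← hm] at h
  have e1 : ((Matrix.of fun _ _ : Fin 1 => x).map f).map s = 0 := by ext; simp [hx]
  have e2 : (Matrix.of fun _ _ : Fin 1 => x).map r = Matrix.of fun _ _ => r x := by ext; simp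
  rw [e1, e2, norm_blockOp_zero, norm_blockOp_scalar] at h
  exact hr (by rw [norm_eq_zero.mp h.symm, map_zero])

/-- Extension along completely isometric embeddings rather than subspaces. -/
theorem IsInjective.exists_extension (hE : E.IsInjective) {i : F.carrier →ₗ[ℂ] G.carrier}
    (hi : IsUCIS F G i) {f : F.carrier →ₗ[ℂ] E.carrier} (hf : IsUCC F E f) :
    ∃ g : G.carrier →ₗ[ℂ] E.carrier, IsUCC G E g ∧ ∀ x, g (i x) = f x := by
  let e := LinearEquiv.ofInjective i hi.injective
  have he : ∀ x, e.symm ⟨i x, LinearMap.mem_range_self i x⟩ = x := fun x =>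
    e.symm_apply_eq.mpr (Subtype.ext rfl)
  have hone : G.one ∈ LinearMap.range i := ⟨F.one, hi.map_one⟩
  have hUCC : IsUCC (G.sub (LinearMap.range i) hone) E (f ∘ₗ e.symm.toLinearMap) := by
    refine ⟨?_, fun n A => ?_⟩
    · have : (⟨G.one, hone⟩ : LinearMap.range i) = ⟨i F.one, LinearMap.mem_range_self i _⟩ :=
        Subtype.ext hi.map_one.symm
      change f (e.symm ⟨G.one, hone⟩) = _
      rw [this, he, hf.map_one]
    · refine (hf.mnorm_le n (A.map e.symm)).trans ?_
      rw [← hi.mnorm_eq n (A.map e.symm)]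
      refine le_of_eq (congrArg (G.mnorm n) ?_)
      ext a b
      exact congrArg Subtype.val (e.apply_symm_apply (A a b))
  obtain ⟨g, hg, hgf⟩ := hE G (LinearMap.range i) hone (f ∘ₗ e.symm.toLinearMap) hUCC
  refine ⟨g, hg, fun x => ?_⟩
  have := hgf ⟨i x, LinearMap.mem_range_self i x⟩
  rw [this, LinearMap.comp_apply, LinearEquiv.coe_coe, he]

theorem IsInjective.of_retract (hE : E.IsInjective) {i : F.carrier →ₗ[ℂ] E.carrier}
    {p : E.carrier →ₗ[ℂ] F.carrier} (hi : IsUCC F E i) (hp : IsUCC E F p)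
    (h : ∀ x, p (i x) = x) : F.IsInjective := by
  intro Y Z hZ f hf
  obtain ⟨g, hg, hgf⟩ := hE Y Z hZ (i ∘ₗ f) (hi.comp hf)
  exact ⟨p ∘ₗ g, hp.comp hg, fun z => by
    rw [LinearMap.comp_apply, hgf, LinearMap.comp_apply, h]⟩

variable (H : Type u) [NormedAddCommGroup H] [InnerProductSpace ℂ H] [CompleteSpace H]

theorem isInjective_boundedOps : (boundedOps H).IsInjective := by
  intro Y Z hZ f hf
  obtain ⟨K, i₁, i₂, i₃, r, -, -, hn⟩ := Y.exists_realization
  obtain ⟨f₀, hf₀⟩ := LinearMap.exists_extend f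
  have hfz : ∀ z : Z, f₀ z = f z := fun z => LinearMap.congr_fun hf₀ z
  obtain ⟨g, hg, hgf⟩ := exists_completelyContractive_extension r Z f₀ fun n y hy => by
    have h := hf.mnorm_le n fun i j => ⟨y i j, hy i j⟩
    have e : y.map f₀ = Matrix.map (fun i j => (⟨y i j, hy i j⟩ : Z)) f := by
      ext1 i j
      exact hfz ⟨y i j, hy i j⟩
    rw [e, hn]
    exact h
  refine ⟨g, ⟨?_, fun n A => (hg n A).trans (hn n A).le⟩, fun z => (hgf z z.2).trans (hfz z)⟩
  rw [hgf _ hZ]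
  exact (hfz ⟨_, hZ⟩).trans hf.map_one

end UnitalOperatorSpace

/-! ### Rigidity of minimal maps, boundary subsystems and envelopes -/

section XMaps

open UnitalOperatorSpace

variable {H : Type u} [NormedAddCommGroup H] [InnerProductSpace ℂ H] [CompleteSpace H]
  {X : Submodule ℂ (H →L[ℂ] H)}

/-- For a unit vector `v` and `z = ⟪v, φ a v⟫`, applying the unital contraction `φ` to `a + it`
gives `(Im z + t)² ≤ ‖a‖² + t²` for all real `t`, which forces `Im z = 0`. -/
theorem IsXMap.isSelfAdjoint_apply {φ : (H →L[ℂ] H) →ₗ[ℂ] (H →L[ℂ] H)} (hφ : IsXMap X φ)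
    {a : H →L[ℂ] H} (ha : IsSelfAdjoint a) : IsSelfAdjoint (φ a) := by
  have hone : φ 1 = 1 := hφ.isUCC.map_one
  rw [ContinuousLinearMap.isSelfAdjoint_iff_isSymmetric,
    LinearMap.isSymmetric_iff_inner_map_self_real]
  have key : ∀ v : H, ‖v‖ = 1 → (inner ℂ v (φ a v) : ℂ).im = 0 := fun v hv => by
    set z : ℂ := inner ℂ v (φ a v) with hz
    have h1 : ∀ t : ℝ, (z.im + t) ^ 2 ≤ ‖a‖ ^ 2 + t ^ 2 := fun t => by
      have e1 : inner ℂ v (φ (a + ((t : ℂ) * Complex.I) • 1) v) = z + t * Complex.I := by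
        rw [map_add, map_smul, hone, add_apply, inner_add_right, smul_apply, inner_smul_right,
          one_apply_eq_self, inner_self_eq_norm_sq_to_K, hv]
        simp [hz]
      have e2 : ‖z + t * Complex.I‖ ≤ ‖a + ((t : ℂ) * Complex.I) • (1 : H →L[ℂ] H)‖ := by
        rw [← e1]
        refine (norm_inner_le_norm _ _).trans ?_
        rw [hv, one_mul]
        refine ((φ _).le_opNorm v).trans ?_
        rw [hv, mul_one]
        exact hφ.norm_le _
      have e3 : ‖a + ((t : ℂ) * Complex.I) • (1 : H →L[ℂ] H)‖ ^ 2 ≤ ‖a‖ ^ 2 + t ^ 2 := by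
        rw [sq, ← CStarRing.norm_star_mul_self]
        have : star (a + ((t : ℂ) * Complex.I) • (1 : H →L[ℂ] H)) *
            (a + ((t : ℂ) * Complex.I) • 1) = a * a + ((t ^ 2 : ℝ) : ℂ) • 1 := by
          rw [star_add, star_smul, star_one, ha.star_eq]
          simp only [RCLike.star_def, map_mul, Complex.conj_ofReal, Complex.conj_I, mul_add,
            add_mul, smul_mul_assoc, mul_smul_comm, one_mul, mul_one, smul_add, smul_smul]
          have : (t : ℂ) * Complex.I * (t * -Complex.I) = ((t ^ 2 : ℝ) : ℂ) := by
            push_cast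
            linear_combination -(t : ℂ) ^ 2 * Complex.I_sq
          rw [this]
          module
        rw [this]
        refine (norm_add_le _ _).trans (add_le_add ?_ ?_)
        · rw [sq]
          exact norm_mul_le _ _
        · rw [norm_smul, Complex.norm_real, Real.norm_of_nonneg (sq_nonneg t)]
          exact mul_le_of_le_one_right (sq_nonneg t) ContinuousLinearMap.norm_id_le
      have e4 := Complex.abs_im_le_norm (z + t * Complex.I)
      have e5 : (z + t * Complex.I).im = z.im + t := by simp
      rw [e5] at e4
      calc (z.im + t) ^ 2 = |z.im + t| ^ 2 := (sq_abs _).symm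
        _ ≤ ‖a + ((t : ℂ) * Complex.I) • (1 : H →L[ℂ] H)‖ ^ 2 := by
          gcongr
          exact e4.trans e2
        _ ≤ _ := e3
    by_contra hne
    -- This `t` makes the cross term `2 t Im z` equal to `‖a‖² + 1`, beyond what the inequality
    -- allows.
    have h2 := h1 ((‖a‖ ^ 2 + 1) / (2 * z.im))
    have h3 : 2 * z.im * ((‖a‖ ^ 2 + 1) / (2 * z.im)) = ‖a‖ ^ 2 + 1 := by field_simp
    nlinarith [sq_nonneg z.im]
  intro v
  rcases eq_or_ne v 0 with rfl | hv
  · simp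
  have h1 := key ((‖v‖ : ℂ)⁻¹ • v) (norm_smul_inv_norm hv)
  have hv' : ‖v‖ ≠ 0 := norm_ne_zero_iff.mpr hv
  rw [map_smul, inner_smul_left, inner_smul_right, ← mul_assoc, ← Complex.ofReal_inv,
    Complex.conj_ofReal, ← Complex.ofReal_mul, Complex.im_ofReal_mul] at h1
  have h2 : (inner ℂ v (φ a v) : ℂ).im = 0 := by
    rcases mul_eq_zero.mp h1 with h | h
    · simp [hv'] at h
    · exact h
  rw [← inner_conj_symm] at h2
  rw [Complex.conj_im, neg_eq_zero] at h2
  exact Complex.conj_eq_iff_im.mpr h2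

theorem IsXMap.map_star {φ : (H →L[ℂ] H) →ₗ[ℂ] (H →L[ℂ] H)} (hφ : IsXMap X φ) (a : H →L[ℂ] H) :
    φ (star a) = star (φ a) := by
  have h1 := (hφ.isSelfAdjoint_apply (realPart a).2).star_eq
  have h2 := (hφ.isSelfAdjoint_apply (imaginaryPart a).2).star_eq
  conv_lhs => rw [← realPart_add_I_smul_imaginaryPart a]
  conv_rhs => rw [← realPart_add_I_smul_imaginaryPart a]
  rw [star_add, star_smul, (realPart a).2.star_eq, (imaginaryPart a).2.star_eq, map_add, map_add,
    map_smul, map_smul, star_add, star_smul, h1, h2]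

omit [CompleteSpace H] in
theorem xSeminorm_scalar (φ : (H →L[ℂ] H) →ₗ[ℂ] (H →L[ℂ] H)) (a : H →L[ℂ] H) :
    xSeminorm φ 1 (Matrix.of fun _ _ => a) = ‖φ a‖ := by
  rw [← norm_blockOp_scalar (φ a), xSeminorm]
  rfl

theorem IsXMap.id : IsXMap X LinearMap.id := ⟨isUCC_id, fun _ _ => rfl⟩

theorem IsXMap.comp {ψ φ : (H →L[ℂ] H) →ₗ[ℂ] (H →L[ℂ] H)} (hψ : IsXMap X ψ) (hφ : IsXMap X φ) :
    IsXMap X (ψ ∘ₗ φ) :=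
  ⟨hψ.isUCC.comp hφ.isUCC, fun x hx => by rw [LinearMap.comp_apply, hφ.fixes x hx, hψ.fixes x hx]⟩

theorem IsXMap.comp_le {ψ φ : (H →L[ℂ] H) →ₗ[ℂ] (H →L[ℂ] H)} (hψ : IsXMap X ψ)
    (hφ : IsXMap X φ) : XSeminormLE X (ψ ∘ₗ φ) φ :=
  ⟨hψ.comp hφ, fun n A => hψ.isUCC.mnorm_le n (A.map φ)⟩

theorem IsXMap.average {φ : ℕ → (H →L[ℂ] H) →ₗ[ℂ] (H →L[ℂ] H)} (hφ : ∀ k, IsXMap X (φ k))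
    (N : ℕ) : IsXMap X (((N + 1 : ℕ) : ℂ)⁻¹ • ∑ k ∈ Finset.range (N + 1), φ k) := by
  have hN : ((N + 1 : ℕ) : ℂ) ≠ 0 := Nat.cast_ne_zero.mpr N.succ_ne_zero
  have hfix : ∀ a, (∀ k, φ k a = a) →
      (((N + 1 : ℕ) : ℂ)⁻¹ • ∑ k ∈ Finset.range (N + 1), φ k) a = a := fun a ha => by
    simp only [LinearMap.smul_apply, LinearMap.sum_apply, ha, Finset.sum_const, Finset.card_range]
    rw [← Nat.cast_smul_eq_nsmul ℂ, inv_smul_smul₀ hN]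
  refine ⟨⟨hfix 1 fun k => (hφ k).isUCC.map_one, fun n A => ?_⟩,
    fun x hx => hfix x fun k => (hφ k).fixes x hx⟩
  have e : A.map (((N + 1 : ℕ) : ℂ)⁻¹ • ∑ k ∈ Finset.range (N + 1), φ k) =
      ((N + 1 : ℕ) : ℂ)⁻¹ • ∑ k ∈ Finset.range (N + 1), A.map (φ k) := by
    ext1 i j
    simp [Matrix.sum_apply]
  change ‖blockOp (K := H) _‖ ≤ ‖blockOp A‖
  rw [e, norm_blockOp_smul, norm_inv, Complex.norm_natCast, inv_mul_le_iff₀ (by positivity)]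
  refine (norm_blockOp_sum_le _ _).trans ((Finset.sum_le_card_nsmul _ _ ‖blockOp A‖
    fun k _ => (hφ k).isUCC.mnorm_le n A).trans ?_)
  simp

theorem IsXMap.pow {φ : Module.End ℂ (H →L[ℂ] H)} (hφ : IsXMap X φ) (k : ℕ) :
    IsXMap X (φ ^ k) := by
  induction k with
  | zero => exact IsXMap.id
  | succ k ih => exact ih.comp hφ

theorem IsXSeminormMinimal.norm_eq {φ ψ : (H →L[ℂ] H) →ₗ[ℂ] (H →L[ℂ] H)}
    (hφ : IsXSeminormMinimal X φ) (hψ : XSeminormLE X ψ φ) (a : H →L[ℂ] H) : ‖ψ a‖ = ‖φ a‖ := by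
  rw [← xSeminorm_scalar, ← xSeminorm_scalar, hφ.2 ψ hψ]

theorem IsXSeminormMinimal.of_le {φ ψ : (H →L[ℂ] H) →ₗ[ℂ] (H →L[ℂ] H)}
    (hφ : IsXSeminormMinimal X φ) (hψ : XSeminormLE X ψ φ) : IsXSeminormMinimal X ψ := by
  refine ⟨hψ.isXMap, fun χ hχ => ?_⟩
  rw [hφ.2 ψ hψ]
  exact hφ.2 χ ⟨hχ.isXMap, fun n A => (hχ.le n A).trans (hψ.le n A)⟩

/-- With `T` the average of the powers up to `N`, minimality gives `‖φ b‖ = ‖T (φ b)‖`. For `b = a -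
φ a` the right side telescopes and is `O(1 / N)`. -/
theorem IsXSeminormMinimal.apply_apply {φ : Module.End ℂ (H →L[ℂ] H)}
    (hφ : IsXSeminormMinimal X φ) (a : H →L[ℂ] H) : φ (φ a) = φ a := by
  have hbound : ∀ N : ℕ, ‖φ (a - φ a)‖ ≤ 2 * ‖a‖ * ((N : ℝ) + 1)⁻¹ := fun N => by
    set T : Module.End ℂ (H →L[ℂ] H) :=
      ((N + 1 : ℕ) : ℂ)⁻¹ • ∑ k ∈ Finset.range (N + 1), φ ^ k with hT
    have hTX : IsXMap X T := IsXMap.average (fun k => hφ.1.pow k) N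
    rw [← hφ.norm_eq (hTX.comp_le hφ.1)]
    have htel : T (φ (a - φ a)) = ((N + 1 : ℕ) : ℂ)⁻¹ • (φ a - (φ ^ (N + 1)) (φ a)) := by
      rw [hT, LinearMap.smul_apply, LinearMap.sum_apply]
      congr 1
      refine (Finset.sum_congr rfl fun k _ => ?_).trans
        (Finset.sum_range_sub' (fun k => (φ ^ k) (φ a)) (N + 1))
      rw [map_sub, map_sub, pow_succ φ k, Module.End.mul_apply]
    rw [LinearMap.comp_apply, htel, norm_smul, norm_inv, Complex.norm_natCast, mul_comm]
    push_cast
    gcongr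
    refine (norm_sub_le _ _).trans ?_
    have h1 := hφ.1.norm_le a
    have h2 := (hφ.1.pow (N + 1)).norm_le (φ a)
    linarith
  have hlim : Filter.Tendsto (fun N : ℕ => 2 * ‖a‖ * ((N : ℝ) + 1)⁻¹) Filter.atTop (nhds 0) := by
    simpa [one_div] using (tendsto_one_div_add_atTop_nhds_zero_nat (𝕜 := ℝ)).const_mul (2 * ‖a‖)
  have h0 := norm_le_zero_iff.mp (ge_of_tendsto' hlim hbound)
  rw [map_sub, sub_eq_zero] at h0
  exact h0.symm

/-- Rigidity: `φ ∘ ψ` is the identity on the range of `φ` if the seminorm of `φ` is minimal. -/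
theorem IsXSeminormMinimal.rigid {φ ψ : (H →L[ℂ] H) →ₗ[ℂ] (H →L[ℂ] H)}
    (hφ : IsXSeminormMinimal X φ) (hψ : IsXMap X ψ) (a : H →L[ℂ] H) : φ (ψ (φ a)) = φ a := by
  have hle : XSeminormLE X (φ ∘ₗ ψ ∘ₗ φ) φ := (hφ.1.comp hψ).comp_le hφ.1
  have hidem := (hφ.of_le hle).apply_apply a
  -- By idempotence `φ ∘ ψ ∘ φ` kills this difference; having the same seminorm, so does `φ`.
  have h := hφ.norm_eq hle (a - (φ ∘ₗ ψ ∘ₗ φ) a)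
  rw [map_sub, hidem, sub_self, norm_zero, eq_comm, norm_eq_zero, map_sub, sub_eq_zero] at h
  simpa [hφ.apply_apply] using h.symm

theorem IsXMap.isBoundarySubsystem_ker {φ : (H →L[ℂ] H) →ₗ[ℂ] (H →L[ℂ] H)} (hφ : IsXMap X φ) :
    IsBoundarySubsystem X (LinearMap.ker φ) := by
  refine ⟨fun a ha => ?_, fun n A hA => le_antisymm ?_ ?_⟩
  · rw [LinearMap.mem_ker] at ha ⊢
    rw [hφ.map_star, ha, star_zero]
  · refine csInf_le ⟨0, ?_⟩ ⟨0, fun _ _ => Submodule.zero_mem _, by rw [add_zero]⟩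
    rintro _ ⟨Y, -, rfl⟩
    exact norm_blockOp_nonneg _
  · refine le_csInf ⟨_, 0, fun _ _ => Submodule.zero_mem _, rfl⟩ ?_
    rintro _ ⟨Y, hY, rfl⟩
    refine le_trans (le_of_eq ?_) (hφ.isUCC.mnorm_le n (A + Y))
    change _ = ‖blockOp ((A + Y).map φ)‖
    congr 2
    ext1 i j
    have := LinearMap.mem_ker.mp (hY i j)
    simp [this, hφ.fixes _ (hA i j)]

/-- The quotient condition says `‖A‖ ≤ ‖A + B‖` for `A` over `X` and `B` over `I`: the map `x + y ↦
x` on `X + I` is well defined and completely contractive. Wittstock extension gives `ψ`. -/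
theorem IsBoundarySubsystem.exists_isXMap (hX : (1 : H →L[ℂ] H) ∈ X)
    {I : Submodule ℂ (H →L[ℂ] H)} (hI : IsBoundarySubsystem X I) :
    ∃ ψ, IsXMap X ψ ∧ I ≤ LinearMap.ker ψ := by
  have hle : ∀ (n : ℕ) (A B : Matrix (Fin n) (Fin n) (H →L[ℂ] H)), (∀ i j, A i j ∈ X) →
      (∀ i j, B i j ∈ I) → ‖blockOp A‖ ≤ ‖blockOp (A + B)‖ := fun n A B hA hB => by
    rw [← hI.quotient_isometric n A hA]
    refine csInf_le ⟨0, ?_⟩ ⟨B, hB, rfl⟩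
    rintro _ ⟨Y, -, rfl⟩
    exact norm_blockOp_nonneg _
  have hinj : LinearMap.ker (I.mkQ ∘ₗ X.subtype) = ⊥ := by
    refine LinearMap.ker_eq_bot'.mpr fun x hx => Subtype.ext ?_
    have hxI : (x : H →L[ℂ] H) ∈ I := (Submodule.Quotient.mk_eq_zero I).mp hx
    have := hle 1 (Matrix.of fun _ _ => x) (-Matrix.of fun _ _ => (x : H →L[ℂ] H)) (fun _ _ => x.2)
      (by intro i j; exact I.neg_mem hxI)
    rw [add_neg_cancel, norm_blockOp_zero, norm_blockOp_scalar] at this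
    exact norm_le_zero_iff.mp this
  obtain ⟨g, hg⟩ := LinearMap.exists_leftInverse_of_injective _ hinj
  let φ₀ : (H →L[ℂ] H) →ₗ[ℂ] (H →L[ℂ] H) := X.subtype ∘ₗ g ∘ₗ I.mkQ
  have hφX : ∀ x ∈ X, φ₀ x = x := fun x hx =>
    congrArg Subtype.val (LinearMap.congr_fun hg ⟨x, hx⟩)
  have hφI : ∀ y ∈ I, φ₀ y = 0 := fun y hy => by
    have : I.mkQ y = 0 := (Submodule.Quotient.mk_eq_zero I).mpr hy
    simp [φ₀, -Submodule.mkQ_apply, this]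
  obtain ⟨ψ, hψ, hψZ⟩ := exists_completelyContractive_extension
    (LinearMap.id : (H →L[ℂ] H) →ₗ[ℂ] (H →L[ℂ] H)) (X ⊔ I) φ₀ fun n A hA => by
      choose B hB C hC hBC using fun i j => Submodule.mem_sup.mp (hA i j)
      obtain rfl : A = Matrix.of B + Matrix.of C := by ext1 i j; exact (hBC i j).symm
      have e : (Matrix.of B + Matrix.of C).map φ₀ = Matrix.of B := by
        ext1 i j
        simp [hφX _ (hB i j), hφI _ (hC i j)]
      rw [e]
      exact hle n (Matrix.of B) (Matrix.of C) hB hC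
  have hfix : ∀ x ∈ X, ψ x = x := fun x hx =>
    (hψZ x (Submodule.mem_sup_left hx)).trans (hφX x hx)
  exact ⟨ψ, ⟨⟨hfix 1 hX, hψ⟩, hfix⟩, fun y hy => LinearMap.mem_ker.mpr
    ((hψZ y (Submodule.mem_sup_right hy)).trans (hφI y hy))⟩

theorem IsXSeminormMinimal.isPrecMinimal {φ : (H →L[ℂ] H) →ₗ[ℂ] (H →L[ℂ] H)}
    (hφ : IsXSeminormMinimal X φ) : IsPrecMinimal X φ := by
  refine ⟨⟨hφ.1, LinearMap.ext hφ.apply_apply⟩, fun ψ hψ => LinearMap.ext fun a => ?_⟩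
  have h1 := LinearMap.congr_fun hψ.comp_left a
  have h2 := LinearMap.congr_fun hψ.comp_right a
  have h3 := hφ.rigid hψ.isXProjection.isXMap a
  simp only [LinearMap.comp_apply] at h1 h2
  rw [h1, h2] at h3
  exact h3

theorem IsXProjection.isInjective_range {φ : (H →L[ℂ] H) →ₗ[ℂ] (H →L[ℂ] H)}
    (hφ : IsXProjection X φ) :
    ((boundedOps H).sub (LinearMap.range φ) hφ.one_mem_range).IsInjective := by
  refine (isInjective_boundedOps H).of_retract (isUCIS_subtype _ hφ.one_mem_range).isUCC
    (hφ.isXMap.isUCC.codRestrict _ hφ.one_mem_range fun x => LinearMap.mem_range_self φ x) ?_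
  rintro ⟨_, a, rfl⟩
  exact Subtype.ext (LinearMap.congr_fun hφ.idem a)

/-- An injective `F` between `X` and the range gives a ucc retraction `ρ` onto `F`. For the `X`-map
`ψ = ρ ∘ φ`, rigidity gives `φ ∘ ψ ∘ φ = φ`; as `ψ` has values in `F`, where `φ` is the identity,
the range of `φ` lies in `F`. -/
theorem IsXSeminormMinimal.isInjectiveEnvelope {φ : (H →L[ℂ] H) →ₗ[ℂ] (H →L[ℂ] H)}
    (hφ : IsXSeminormMinimal X φ) (hX : (1 : H →L[ℂ] H) ∈ X) :
    IsInjectiveEnvelope ((boundedOps H).sub X hX)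
      ((boundedOps H).sub (LinearMap.range φ) hφ.isPrecMinimal.1.one_mem_range)
      (φ.rangeRestrict ∘ₗ X.subtype) := by
  have hP := hφ.isPrecMinimal.1
  refine ⟨⟨Subtype.ext hφ.1.isUCC.map_one, fun n A => ?_⟩, hP.isInjective_range,
    fun F hF hXF hinj => ?_⟩
  · change ‖blockOp (K := H) _‖ = ‖blockOp (K := H) _‖
    congr 2
    ext1 i j
    exact hφ.1.fixes _ (A i j).2
  · obtain ⟨ρ, hρ, hρF⟩ := hinj _ F hF LinearMap.id isUCC_id
    let π := φ.codRestrict (LinearMap.range φ) fun x => LinearMap.mem_range_self φ x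
    have hπ : IsUCC (boundedOps H) ((boundedOps H).sub (LinearMap.range φ) hP.one_mem_range) π :=
      hφ.1.isUCC.codRestrict _ hP.one_mem_range _
    let ψ : (H →L[ℂ] H) →ₗ[ℂ] (H →L[ℂ] H) :=
      (LinearMap.range φ).subtype ∘ₗ F.subtype ∘ₗ ρ ∘ₗ π
    have hψ : IsXMap X ψ := by
      refine ⟨(isUCIS_subtype _ hP.one_mem_range).isUCC.comp
        ((isUCIS_subtype F hF).isUCC.comp (hρ.comp hπ)), fun x hx => ?_⟩
      have h1 : ρ (π x) = ⟨π x, hXF ⟨x, hx⟩⟩ := hρF ⟨π x, hXF ⟨x, hx⟩⟩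
      have h2 : ψ x = φ x := congrArg (fun y : F => (y.1 : H →L[ℂ] H)) h1
      rw [h2, hφ.1.fixes x hx]
    refine Submodule.eq_top_iff'.mpr ?_
    rintro ⟨_, a, rfl⟩
    have h1 := hφ.rigid hψ a
    obtain ⟨b, hb⟩ : ψ (φ a) ∈ LinearMap.range φ := (ρ (π (φ a))).1.2
    rw [← hb, hφ.apply_apply, hb] at h1
    have h2 : (⟨φ a, a, rfl⟩ : LinearMap.range φ) = (ρ (π (φ a))).1 := Subtype.ext h1.symm
    rw [h2]
    exact (ρ (π (φ a))).2

/-- A minimal `φ₁` provides `β : S → B(H)` with values in its range. Minimality of the envelope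
forces `φ ∘ β = id`, so `φ` has the kernel of the `X`-map `β ∘ φ`, to which rigidity applies. -/
theorem UnitalOperatorSpace.IsInjectiveEnvelope.maximal_ker (hX : (1 : H →L[ℂ] H) ∈ X)
    {S : UnitalOperatorSpace.{u}} {ι : X →ₗ[ℂ] S.carrier} {φ : (H →L[ℂ] H) →ₗ[ℂ] S.carrier}
    (hS : IsInjectiveEnvelope ((boundedOps H).sub X hX) S ι) (hφ : IsUCC (boundedOps H) S φ)
    (hι : ∀ x : X, φ x = ι x) : Maximal (IsBoundarySubsystem X) (LinearMap.ker φ) := by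
  obtain ⟨φ₁, hφ₁, -⟩ := exists_isXSeminormMinimal (X := X) IsXMap.id
  obtain ⟨β₀, hβ₀, hβ₀ι⟩ := (isInjective_boundedOps H).exists_extension hS.isUCIS
    (isUCIS_subtype (E := boundedOps H) X hX).isUCC
  let β : S.carrier →ₗ[ℂ] (H →L[ℂ] H) := φ₁ ∘ₗ β₀
  have hβ : IsUCC S (boundedOps H) β := hφ₁.1.isUCC.comp hβ₀
  have hθ : IsXMap X (β ∘ₗ φ) := ⟨hβ.comp hφ, fun x hx => by
    have h1 : φ x = ι ⟨x, hx⟩ := hι ⟨x, hx⟩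
    have h2 : β₀ (ι ⟨x, hx⟩) = x := hβ₀ι ⟨x, hx⟩
    simp [β, h1, h2, hφ₁.1.fixes x hx]⟩
  have hφ₁β : ∀ s, φ₁ (β s) = β s := fun s => hφ₁.apply_apply _
  have hrig : ∀ a, β (φ (φ₁ a)) = φ₁ a := fun a => by
    rw [← hφ₁β]
    exact hφ₁.rigid hθ a
  have hone : S.one ∈ LinearMap.range (φ ∘ₗ φ₁) := ⟨1, (hφ.comp hφ₁.1.isUCC).map_one⟩
  -- By `hrig` this range is a completely contractive retract of `B(H)`, hence injective, and it
  -- contains the copy of `X`.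
  have htop : LinearMap.range (φ ∘ₗ φ₁) = ⊤ := by
    refine hS.eq_top _ hone (fun x => ⟨x, ?_⟩) ?_
    · rw [LinearMap.comp_apply, hφ₁.1.fixes _ x.2, hι]
    · refine (isInjective_boundedOps H).of_retract
        (hβ.comp (isUCIS_subtype _ hone).isUCC)
        ((hφ.comp hφ₁.1.isUCC).codRestrict _ hone fun x => LinearMap.mem_range_self _ x) ?_
      rintro ⟨_, a, rfl⟩
      refine Subtype.ext ?_
      change φ (φ₁ (β (φ (φ₁ a)))) = φ (φ₁ a)
      rw [hφ₁β, hrig]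
  have hφβ : ∀ s, φ (β s) = s := fun s => by
    obtain ⟨a, rfl⟩ : s ∈ LinearMap.range (φ ∘ₗ φ₁) := htop ▸ Submodule.mem_top
    exact congrArg φ (hrig a)
  have hker : LinearMap.ker (β ∘ₗ φ) = LinearMap.ker φ := by
    ext a
    refine ⟨fun h => ?_, fun h => ?_⟩
    · rw [LinearMap.mem_ker, LinearMap.comp_apply] at h
      rw [LinearMap.mem_ker, ← hφβ (φ a), h, map_zero]
    · rw [LinearMap.mem_ker] at h
      rw [LinearMap.mem_ker, LinearMap.comp_apply, h, map_zero]
  refine ⟨hker ▸ hθ.isBoundarySubsystem_ker, fun J hJ hle a ha => ?_⟩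
  obtain ⟨ψ, hψ, hJψ⟩ := hJ.exists_isXMap hX
  -- Thus `J` also contains `β (φ a)`, which `ψ` kills; but `φ₁ ∘ ψ` fixes the range of `φ₁`, so `β
  -- (φ a) = 0`.
  have h1 : a - β (φ a) ∈ J := hle (by rw [LinearMap.mem_ker, map_sub, hφβ, sub_self])
  have h2 : β (φ a) ∈ J := by simpa using J.sub_mem ha h1
  have h3 := hφ₁.rigid hψ (β (φ a))
  rw [hφ₁β, LinearMap.mem_ker.mp (hJψ h2), map_zero] at h3
  rw [LinearMap.mem_ker, ← hφβ (φ a), ← h3, map_zero]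

end XMaps

end

theorem mainTheorem8 {H : Type u} [NormedAddCommGroup H] [InnerProductSpace ℂ H]
    [CompleteSpace H] (X : Submodule ℂ (H →L[ℂ] H)) (hX : (1 : H →L[ℂ] H) ∈ X)
    (I : Submodule ℂ (H →L[ℂ] H)) :
    List.TFAE [
      Maximal (IsBoundarySubsystem X) I,
      ∃ (S : UnitalOperatorSpace.{u}) (ι : X →ₗ[ℂ] S.carrier)
        (φ : (H →L[ℂ] H) →ₗ[ℂ] S.carrier),
        UnitalOperatorSpace.IsInjectiveEnvelope
          ((UnitalOperatorSpace.boundedOps H).sub X hX) S ι ∧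
        UnitalOperatorSpace.IsUCC (UnitalOperatorSpace.boundedOps H) S φ ∧
        (∀ x : X, φ x = ι x) ∧
        I = LinearMap.ker φ,
      ∃ φ : (H →L[ℂ] H) →ₗ[ℂ] (H →L[ℂ] H),
        IsXSeminormMinimal X φ ∧ I = LinearMap.ker φ,
      ∃ (φ : (H →L[ℂ] H) →ₗ[ℂ] (H →L[ℂ] H)) (hφ : IsPrecMinimal X φ),
        UnitalOperatorSpace.IsInjectiveEnvelope
          ((UnitalOperatorSpace.boundedOps H).sub X hX)
          ((UnitalOperatorSpace.boundedOps H).sub (LinearMap.range φ) hφ.1.one_mem_range)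
          (φ.rangeRestrict ∘ₗ X.subtype) ∧
        I = LinearMap.ker φ] := by
  tfae_have 1 → 3 := fun hI => by
    obtain ⟨ψ, hψ, hIψ⟩ := hI.prop.exists_isXMap hX
    obtain ⟨φ, hφ, hφψ⟩ := exists_isXSeminormMinimal hψ
    -- Passing to a smaller seminorm enlarges the kernel, so `I ≤ ker ψ ≤ ker φ`, and maximality
    -- gives equality.
    refine ⟨φ, hφ, hI.eq_of_le hφ.1.isBoundarySubsystem_ker fun a ha => ?_⟩
    have h := hφψ.le 1 (Matrix.of fun _ _ => a)
    rw [xSeminorm_scalar, xSeminorm_scalar, LinearMap.mem_ker.mp (hIψ ha), norm_zero] at h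
    exact norm_le_zero_iff.mp h
  tfae_have 3 → 4 := fun ⟨φ, hφ, hI⟩ => ⟨φ, hφ.isPrecMinimal, hφ.isInjectiveEnvelope hX, hI⟩
  tfae_have 4 → 2 := fun ⟨φ, hφ, henv, hI⟩ =>
    ⟨_, _, φ.rangeRestrict, henv, hφ.1.isXMap.isUCC.codRestrict _ hφ.1.one_mem_range _,
      fun _ => rfl, hI.trans φ.ker_rangeRestrict.symm⟩
  tfae_have 2 → 1 := fun ⟨S, ι, φ, hS, hφ, hι, hI⟩ => hI ▸ hS.maximal_ker hX hφ hι
  tfae_finish
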